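/- Let $n\ge 1$, $p\in\mathbb{C}^n$ and $\hbar>0$. For multiindices write $|R|=\sum_i r_i$, $R!=\prod_i r_i!$, $\binom{R}{I}=\prod_i\binom{r_i}{i_i}$. For $f\in C^\infty(\mathbb{C}^n)$ (smooth in the real sense), $R,S\in\mathbb{N}^n$, $m\in\mathbb{N}$ and $0\le \ell\le 2^m-1$ define recursively $h_{m,\ell,R,S}(f)\in[0,\infty]$ by $$h_{0,0,R,S}(f)=\sum_{N\in\mathbb{N}^n}\frac{(2\hbar)^{|R|+|S|+|N|}}{N!}\left|\frac{\partial^{|R|+|S|+|N|}f}{\partial z^R\,\partial\bar z^{N+S}}(p)\right|^2,$$ $$h_{m,\ell,R,S}(f)=\sum_{N\in\mathbb{N}^n}\frac1{N!}\left(\sum_{I\le R}\ \sum_{J\le N+S}\binom{R}{I}\binom{N+S}{J}\,h'_{I,J}\right)^2\quad(m\ge 1),$$ where $h'_{I,J}=h_{m-1,\ell/2,I,J}(f)$ for even $\ell$ and $h'_{I,J}=h_{m-1,(\ell-1)/2,J,I}(f)$ for odd $\ell$, and let $\|f\|_{m,\ell,R,S}=h_{m,\ell,R,S}(f)^{1/2^{m+1}}$.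 Let $\tilde{\mathcal A}_{p,\hbar}$ be the space of all $f\in C^\infty(\mathbb{C}^n)$ for which all $\|f\|_{m,\ell,R,S}$ are finite, and let $\mathcal A_{p,\hbar}$ be its quotient by the functions whose $\infty$-jet at $p$ vanishes, with the locally convex topology defined by the seminorms $\|\cdot\|_{m,\ell,R,S}$. For $\alpha\in\mathbb{C}$ the Wick product on $\mathcal A_{p,\hbar}$ is $$f\star_\alpha g=\sum_{N\in\mathbb{N}^n}\frac{(2\alpha)^{|N|}}{N!}\,\frac{\partial^{|N|}f}{\partial z^N}\,\frac{\partial^{|N|}g}{\partial\bar z^N},$$ the series being summed in the topology of $\mathcal A_{p,\hbar}$. Then the following holds. 1. For every $\alpha\in\mathbb{C}$, $(\mathcal A_{p,\hbar},\star_\alpha)$ is not locally $m$-convex: there is no set of seminorms $q$ defining the topology of $\mathcal A_{p,\hbar}$ such that $q(a\star_\alpha b)\le q(a)\,q(b)$ for all $a,b$. 2. For every $\alpha\in\mathbb{C}$, $(\mathcal A_{p,\hbar},\star_\alpha)$ has no general holomorphic functional calculus, not even for entire functions: it is not true that for every $a\in\mathcal A_{p,\hbar}$ there is a linear map $\Phi$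 (continuous or not) from the algebra of entire functions on $\mathbb{C}$ to $\mathcal A_{p,\hbar}$ with $\Phi(1)=1$, $\Phi(\mathrm{id})=a$ and $\Phi(fg)=\Phi(f)\star_\alpha\Phi(g)$ for all $f,g$. 3. The series $f(w)=\sum_{r=0}^\infty w^r/(r!)^{1/4}$ converges for all $w\in\mathbb{C}$ and defines an entire function with the following properties for each $j=1,\dots,n$. Put $F(z)=f(z^j)$ on $\mathbb{C}^n$. (a) For $\beta\in\mathbb{C}$ the series $\sum_{N}\frac{(2\beta)^{|N|}}{N!}\frac{\partial^{|N|}F}{\partial z^N}(0)\frac{\partial^{|N|}\bar F}{\partial\bar z^N}(0)$ of $F\star_\beta\bar F$ at $0$ is summable if and only if $\beta=0$. (b) $F\notin\tilde{\mathcal A}_{p,\hbar}$. (c) The coordinate function $z^j$ belongs to $\tilde{\mathcal A}_{p,\hbar}$, and for every $\alpha\in\mathbb{C}$ the $\star_\alpha$-power series $\sum_{r}(r!)^{-1/4}\,(z^j)^{\star_\alpha r}$ does not converge in $\mathcal A_{p,\hbar}$; moreover there is no map $\Phi$ as in 2 for $a=z^j$. -/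

import Mathlib

open Finset Filter Topology
open scoped ContDiff ENNReal Nat

namespace WickStar

/-- The algebra `C^∞(ℂⁿ)` of smooth (in the real sense) complex-valued functions on `ℂⁿ`, with the
pointwise operations. -/
def Smooth (n : ℕ) : Subalgebra ℂ ((Fin n → ℂ) → ℂ) where
  carrier := {f | ContDiff ℝ ∞ f}
  mul_mem' {f g} hf hg := by
    have hf' : ContDiff ℝ ∞ f := hf
    have hg' : ContDiff ℝ ∞ g := hg
    exact hf'.mul hg'
  add_mem' {f g} hf hg := by
    have hf' : ContDiff ℝ ∞ f := hf
    have hg' : ContDiff ℝ ∞ g := hg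
    exact hf'.add hg'
  algebraMap_mem' c := by
    have : ContDiff ℝ ∞ (fun _ : Fin n → ℂ => c) := contDiff_const
    exact this

theorem Smooth.contDiff {n : ℕ} (f : Smooth n) : ContDiff ℝ ∞ (f : (Fin n → ℂ) → ℂ) := f.2

theorem Smooth.diff {n : ℕ} (f : Smooth n) : Differentiable ℝ (f : (Fin n → ℂ) → ℂ) :=
  (Smooth.contDiff f).differentiable (by simp)

theorem Smooth.contDiff_fderiv {n : ℕ} (f : Smooth n) :
    ContDiff ℝ ∞ (fderiv ℝ (f : (Fin n → ℂ) → ℂ)) :=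
  (Smooth.contDiff f).fderiv_right (by simp)

/-- The real directional derivative in the direction `v`, as a derivation of `C^∞(ℂⁿ)`. -/
noncomputable def dirDeriv {n : ℕ} (v : Fin n → ℂ) : Derivation ℂ (Smooth n) (Smooth n) where
  toFun f := ⟨fun z => fderiv ℝ (f : (Fin n → ℂ) → ℂ) z v,
    (Smooth.contDiff_fderiv f).clm_apply contDiff_const⟩
  map_add' f g := by
    ext z
    have := fderiv_add (Smooth.diff f z) (Smooth.diff g z)
    simpa using DFunLike.congr_fun this v
  map_smul' c f := by
    ext z
    have := fderiv_const_smul (𝕜 := ℝ) (Smooth.diff f z) c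
    simpa using DFunLike.congr_fun this v
  map_one_eq_zero' := by
    ext z
    simp
  leibniz' f g := by
    ext z
    have := fderiv_mul (Smooth.diff f z) (Smooth.diff g z)
    simpa using DFunLike.congr_fun this v

/-- The Wirtinger derivative `∂/∂z^j = (∂/∂x^j - i ∂/∂y^j) / 2`. -/
noncomputable def dz {n : ℕ} (j : Fin n) : Derivation ℂ (Smooth n) (Smooth n) :=
  (1 / 2 : ℂ) • (dirDeriv (Pi.single j 1) - Complex.I • dirDeriv (Pi.single j Complex.I))

/-- The Wirtinger derivative `∂/∂z̄^j = (∂/∂x^j + i ∂/∂y^j) / 2`. -/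
noncomputable def dzbar {n : ℕ} (j : Fin n) : Derivation ℂ (Smooth n) (Smooth n) :=
  (1 / 2 : ℂ) • (dirDeriv (Pi.single j 1) + Complex.I • dirDeriv (Pi.single j Complex.I))

/-- `D^R = D_1^{r_1} ⋯ D_n^{r_n}` for a multiindex `R` and (commuting) operators `D_1, …, D_n`. -/
noncomputable def multiPow {n : ℕ} {E : Type} [AddCommGroup E] [Module ℂ E]
    (D : Fin n → Module.End ℂ E) (R : Fin n → ℕ) : Module.End ℂ E :=
  ((List.finRange n).map fun j => D j ^ R j).prod

/-- `∂^{|R|} / ∂z^R`. -/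
noncomputable def dzPow {n : ℕ} (R : Fin n → ℕ) : Module.End ℂ (Smooth n) :=
  multiPow (fun j => (dz j : Smooth n →ₗ[ℂ] Smooth n)) R

/-- `∂^{|R|} / ∂z̄^R`. -/
noncomputable def dzbarPow {n : ℕ} (R : Fin n → ℕ) : Module.End ℂ (Smooth n) :=
  multiPow (fun j => (dzbar j : Smooth n →ₗ[ℂ] Smooth n)) R

/-- `|R| = r_1 + ⋯ + r_n`. -/
def mdeg {n : ℕ} (R : Fin n → ℕ) : ℕ := ∑ j, R j

/-- `R! = r_1! ⋯ r_n!`. -/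
def mfact {n : ℕ} (R : Fin n → ℕ) : ℕ := ∏ j, (R j)!

/-- The multiindex binomial coefficient. -/
def mchoose {n : ℕ} (R I : Fin n → ℕ) : ℕ := ∏ j, (R j).choose (I j)

/-! Commutation and the Leibniz rule. -/

theorem dirDeriv_comm {n : ℕ} (v w : Fin n → ℂ) (f : Smooth n) :
    dirDeriv v (dirDeriv w f) = dirDeriv w (dirDeriv v f) := by
  ext z
  have hs : IsSymmSndFDerivAt ℝ (f : (Fin n → ℂ) → ℂ) z :=
    (Smooth.contDiff f).contDiffAt.isSymmSndFDerivAt (by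
      simp only [minSmoothness_of_isRCLikeNormedField]; exact WithTop.coe_le_coe.2 le_top)
  have hd : DifferentiableAt ℝ (fderiv ℝ (f : (Fin n → ℂ) → ℂ)) z :=
    (Smooth.contDiff_fderiv f).differentiable (by simp) z
  have key : ∀ u : Fin n → ℂ, fderiv ℝ (fun z => fderiv ℝ (f : (Fin n → ℂ) → ℂ) z u) z =
      (fderiv ℝ (fderiv ℝ (f : (Fin n → ℂ) → ℂ)) z).flip u := by
    intro u
    rw [fderiv_clm_apply hd (differentiableAt_const u)]
    simp
  change fderiv ℝ (fun z => fderiv ℝ (f : (Fin n → ℂ) → ℂ) z w) z v =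
    fderiv ℝ (fun z => fderiv ℝ (f : (Fin n → ℂ) → ℂ) z v) z w
  rw [key, key]
  exact hs v w

theorem dz_dz {n : ℕ} (i j : Fin n) (f : Smooth n) : dz i (dz j f) = dz j (dz i f) := by
  have h := fun a b => dirDeriv_comm (Pi.single i a : Fin n → ℂ) (Pi.single j b) f
  simp only [dz, Derivation.smul_apply, Derivation.sub_apply, Derivation.map_smul, map_sub, h]
  module

theorem dzbar_dzbar {n : ℕ} (i j : Fin n) (f : Smooth n) :
    dzbar i (dzbar j f) = dzbar j (dzbar i f) := by
  have h := fun a b => dirDeriv_comm (Pi.single i a : Fin n → ℂ) (Pi.single j b) f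
  simp only [dzbar, Derivation.smul_apply, Derivation.add_apply, Derivation.map_smul, map_add, h]
  module

theorem dzbar_dz {n : ℕ} (i j : Fin n) (f : Smooth n) : dzbar i (dz j f) = dz j (dzbar i f) := by
  have h := fun a b => dirDeriv_comm (Pi.single i a : Fin n → ℂ) (Pi.single j b) f
  simp only [dz, dzbar, Derivation.smul_apply, Derivation.sub_apply, Derivation.add_apply,
    Derivation.map_smul, map_sub, map_add, h]
  module

section multi
variable {n : ℕ} {E : Type} [AddCommGroup E] [Module ℂ E]

theorem multiPow_comm {D : Fin n → Module.End ℂ E} {T : Module.End ℂ E}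
    (h : ∀ j, Commute T (D j)) (R : Fin n → ℕ) : Commute T (multiPow D R) := by
  apply Commute.list_prod_right
  intro x hx
  obtain ⟨j, -, rfl⟩ := List.mem_map.1 hx
  exact (h j).pow_right _

theorem multiPow_zero (D : Fin n → Module.End ℂ E) : multiPow D 0 = 1 := by
  simp [multiPow]

theorem multiPow_add_single {D : Fin n → Module.End ℂ E} (h : ∀ i j, Commute (D i) (D j))
    (R : Fin n → ℕ) (i : Fin n) :
    multiPow D (R + Pi.single i 1) = multiPow D R * D i := by
  have aux : ∀ l : List (Fin n), l.Nodup →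
      (l.map fun j => D j ^ (R + Pi.single i 1 : Fin n → ℕ) j).prod =
        (l.map fun j => D j ^ R j).prod * (if i ∈ l then D i else 1) := by
    intro l
    induction l with
    | nil => simp
    | cons a l ih =>
      intro hl
      rw [List.nodup_cons] at hl
      rw [List.map_cons, List.prod_cons, ih hl.2, List.map_cons, List.prod_cons]
      by_cases hia : i = a
      · subst hia
        simp only [hl.1, if_false, List.mem_cons, true_or, if_true, Pi.add_apply,
          Pi.single_eq_same, pow_succ, mul_one]
        have : Commute (D i) (l.map fun j => D j ^ R j).prod := by
          apply Commute.list_prod_right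
          intro x hx
          obtain ⟨j, -, rfl⟩ := List.mem_map.1 hx
          exact (h i j).pow_right _
        rw [mul_assoc, this.eq, mul_assoc]
      · simp [hia, Ne.symm hia, mul_assoc]
  rw [multiPow, aux _ (List.nodup_finRange n)]
  simp [multiPow]

end multi

theorem dzPow_add_single {n : ℕ} (R : Fin n → ℕ) (i : Fin n) (f : Smooth n) :
    dzPow (R + Pi.single i 1) f = dzPow R (dz i f) := by
  unfold dzPow
  rw [multiPow_add_single]
  · rfl
  · intro i j; ext1 f; exact dz_dz i j f

theorem dzbarPow_add_single {n : ℕ} (R : Fin n → ℕ) (i : Fin n) (f : Smooth n) :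
    dzbarPow (R + Pi.single i 1) f = dzbarPow R (dzbar i f) := by
  unfold dzbarPow
  rw [multiPow_add_single]
  · rfl
  · intro i j; ext1 f; exact dzbar_dzbar i j f

theorem dzbarPow_dz {n : ℕ} (R : Fin n → ℕ) (i : Fin n) (f : Smooth n) :
    dzbarPow R (dz i f) = dz i (dzbarPow R f) := by
  have := multiPow_comm (D := fun j => (dzbar j : Smooth n →ₗ[ℂ] Smooth n))
    (T := (dz i : Smooth n →ₗ[ℂ] Smooth n)) (by
      intro j; ext1 f; exact (dzbar_dz j i f).symm) R
  exact (DFunLike.congr_fun this.eq f).symm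

theorem multi_induction {n : ℕ} {P : (Fin n → ℕ) → Prop} (h0 : P 0)
    (hs : ∀ R i, P R → P (R + Pi.single i 1)) (R : Fin n → ℕ) : P R := by
  have : ∀ d (R : Fin n → ℕ), ∑ j, R j = d → P R := by
    intro d
    induction d with
    | zero =>
      intro R hR
      have : R = 0 := by
        ext j; simpa using (Finset.sum_eq_zero_iff.1 hR) j (mem_univ j)
      exact this ▸ h0
    | succ d ih =>
      intro R hR
      have : ∃ i, R i ≠ 0 := by
        by_contra! hc
        simp [hc] at hR
      obtain ⟨i, hi⟩ := this
      have hle : Pi.single i 1 ≤ R := by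
        intro j
        by_cases hj : j = i
        · subst hj; simp; omega
        · simp [hj]
      have hR' : R = (R - Pi.single i 1) + Pi.single i 1 := (tsub_add_cancel_of_le hle).symm
      rw [hR']
      apply hs
      apply ih
      rw [hR'] at hR
      simp only [Pi.add_apply, sum_add_distrib, Finset.sum_pi_single', mem_univ, if_true] at hR
      omega
  exact this _ R rfl

theorem mchoose_succ {n : ℕ} (R I : Fin n → ℕ) (i : Fin n) :
    mchoose (R + Pi.single i 1) (I + Pi.single i 1) =
      mchoose R I + mchoose R (I + Pi.single i 1) := by
  have hh : ∀ A B : Fin n → ℕ, mchoose A B =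
      (A i).choose (B i) * ∏ j ∈ univ.erase i, (A j).choose (B j) :=
    fun A B => (Finset.mul_prod_erase univ (fun j => (A j).choose (B j)) (mem_univ i)).symm
  rw [hh, hh, hh]
  have h1 : ∀ j ∈ univ.erase i, ((R + Pi.single i 1 : Fin n → ℕ) j).choose ((I + Pi.single i 1 : Fin n → ℕ) j) =
      (R j).choose (I j) := by
    intro j hj
    simp [(Finset.mem_erase.1 hj).1]
  have h2 : ∀ j ∈ univ.erase i, (R j).choose ((I + Pi.single i 1 : Fin n → ℕ) j) =
      (R j).choose (I j) := by
    intro j hj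
    simp [(Finset.mem_erase.1 hj).1]
  rw [Finset.prod_congr rfl h1, Finset.prod_congr rfl h2]
  simp [Nat.choose_succ_succ]
  ring

theorem mchoose_of_apply_zero {n : ℕ} (R I : Fin n → ℕ) (i : Fin n) (h : I i = 0) :
    mchoose (R + Pi.single i 1) I = mchoose R I := by
  unfold mchoose
  apply Finset.prod_congr rfl
  intro j _
  by_cases hj : j = i
  · subst hj; simp [h]
  · simp [hj]

theorem mchoose_eq_zero {n : ℕ} {R I : Fin n → ℕ} (h : ¬ I ≤ R) : mchoose R I = 0 := by
  rw [Pi.le_def] at h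
  push Not at h
  obtain ⟨j, hj⟩ := h
  exact Finset.prod_eq_zero (mem_univ j) (Nat.choose_eq_zero_of_lt hj)

/-- The Pascal recursion for weighted sums over `I ≤ R`. -/
theorem sum_mchoose_succ {n : ℕ} {M : Type} [AddCommMonoid M] (R : Fin n → ℕ) (i : Fin n)
    (F : (Fin n → ℕ) → M) :
    ∑ I ∈ Iic (R + Pi.single i 1), mchoose (R + Pi.single i 1) I • F I =
      ∑ I ∈ Iic R, mchoose R I • F I +
      ∑ I ∈ Iic R, mchoose R I • F (I + Pi.single i 1) := by
  have e1 : ∑ I ∈ Iic R, mchoose R I • F I =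
      ∑ I ∈ Iic (R + Pi.single i 1), mchoose R I • F I := by
    apply Finset.sum_subset
    · intro I hI
      rw [mem_Iic] at *
      exact hI.trans (by simp)
    · intro I _ hI
      rw [mem_Iic] at hI
      rw [mchoose_eq_zero hI, zero_smul]
  have e2 : ∑ I ∈ Iic R, mchoose R I • F (I + Pi.single i 1) =
      ∑ I ∈ Iic (R + Pi.single i 1),
        if I i = 0 then 0 else mchoose R (I - Pi.single i 1) • F I := by
    rw [← Finset.sum_filter_add_sum_filter_not (Iic (R + Pi.single i 1)) (fun I : Fin n → ℕ => I i = 0)]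
    rw [Finset.sum_eq_zero (s := Finset.filter (fun I : Fin n → ℕ => I i = 0) _), zero_add]
    · refine Finset.sum_bij' (fun I _ => I + Pi.single i 1) (fun I _ => I - Pi.single i 1)
        ?_ ?_ ?_ ?_ ?_
      · intro I hI
        simp only [mem_filter, mem_Iic] at *
        exact ⟨by gcongr, by simp⟩
      · intro I hI
        simp only [mem_filter, mem_Iic] at *
        exact tsub_le_iff_right.2 hI.1
      · intro I hI; simp
      · intro I hI
        simp only [mem_filter, mem_Iic] at *
        apply tsub_add_cancel_of_le
        intro j
        by_cases hj : j = i
        · subst hj; simp; omega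
        · simp [hj]
      · intro I hI
        simp
    · intro I hI
      simp [(mem_filter.1 hI).2]
  rw [e1, e2, ← Finset.sum_add_distrib]
  apply Finset.sum_congr rfl
  intro I _
  split_ifs with h
  · rw [mchoose_of_apply_zero R I i h, add_zero]
  · have hle : Pi.single i 1 ≤ I := by
      intro j
      by_cases hj : j = i
      · subst hj; simp; omega
      · simp [hj]
    obtain ⟨K, rfl⟩ := exists_add_of_le hle
    rw [add_comm (Pi.single i 1) K, mchoose_succ, add_smul, add_tsub_cancel_right, add_comm]

/-- The Leibniz rule for powers of commuting derivations. -/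
theorem multiPow_leibniz {n : ℕ} (D : Fin n → Derivation ℂ (Smooth n) (Smooth n))
    (h : ∀ i j f, D i (D j f) = D j (D i f)) (R : Fin n → ℕ) :
    ∀ f g : Smooth n,
      multiPow (fun j => (D j : Smooth n →ₗ[ℂ] Smooth n)) R (f * g) =
        ∑ I ∈ Iic R, mchoose R I •
          (multiPow (fun j => (D j : Smooth n →ₗ[ℂ] Smooth n)) I f *
            multiPow (fun j => (D j : Smooth n →ₗ[ℂ] Smooth n)) (R - I) g) := by
  have hc : ∀ i j, Commute (D i : Smooth n →ₗ[ℂ] Smooth n) (D j : Smooth n →ₗ[ℂ] Smooth n) := by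
    intro i j; ext1 f; exact h i j f
  have hadd : ∀ (R : Fin n → ℕ) (i : Fin n) (f : Smooth n),
      multiPow (fun j => (D j : Smooth n →ₗ[ℂ] Smooth n)) (R + Pi.single i 1) f =
      multiPow (fun j => (D j : Smooth n →ₗ[ℂ] Smooth n)) R (D i f) := by
    intro R i f
    rw [multiPow_add_single hc]
    rfl
  induction R using multi_induction with
  | h0 =>
    intro f g
    have : (Iic (0 : Fin n → ℕ)) = {0} := by
      ext I; simp
    rw [this]
    simp [multiPow_zero, mchoose]
  | hs R i ih =>
    intro f g
    rw [hadd, Derivation.leibniz, map_add, smul_eq_mul, smul_eq_mul, ih, mul_comm g, ih,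
      sum_mchoose_succ]
    congr 1
    · apply Finset.sum_congr rfl
      intro I hI
      rw [mem_Iic] at hI
      rw [← hadd, tsub_add_eq_add_tsub hI]
    · apply Finset.sum_congr rfl
      intro I _
      rw [← hadd, add_tsub_add_eq_tsub_right]

theorem dzPow_mul {n : ℕ} (R : Fin n → ℕ) (f g : Smooth n) :
    dzPow R (f * g) = ∑ I ∈ Iic R, mchoose R I • (dzPow I f * dzPow (R - I) g) :=
  multiPow_leibniz dz dz_dz R f g

theorem dzbarPow_mul {n : ℕ} (R : Fin n → ℕ) (f g : Smooth n) :
    dzbarPow R (f * g) = ∑ I ∈ Iic R, mchoose R I • (dzbarPow I f * dzbarPow (R - I) g) :=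
  multiPow_leibniz dzbar dzbar_dzbar R f g

/-! Seminorms. -/

/-- The jet coefficient `∂^{|I|+|J|} f / ∂z^I ∂z̄^J (p)`. -/
noncomputable def jet {n : ℕ} (p : Fin n → ℂ) (I J : Fin n → ℕ) (f : Smooth n) : ℂ :=
  (dzPow I (dzbarPow J f) : (Fin n → ℂ) → ℂ) p

/-- The recursion step
`H ↦ ∑_N 1/N! (∑_{I ≤ R} ∑_{J ≤ N+S} binom(R,I) binom(N+S,J) H(I,J))²`. -/
noncomputable def hStep {n : ℕ} (H : (Fin n → ℕ) → (Fin n → ℕ) → ℝ≥0∞) (R S : Fin n → ℕ) :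
    ℝ≥0∞ :=
  ∑' N : Fin n → ℕ, (mfact N : ℝ≥0∞)⁻¹ *
    (∑ I ∈ Iic R, ∑ J ∈ Iic (N + S),
      (mchoose R I : ℝ≥0∞) * (mchoose (N + S) J : ℝ≥0∞) * H I J) ^ 2

/-- The quantities `h_{m,ℓ,R,S}(f) ∈ [0,∞]` (relevant for `ℓ < 2^m`). -/
noncomputable def hph {n : ℕ} (p : Fin n → ℂ) (ħ : ℝ) (f : Smooth n) :
    (m l : ℕ) → (R S : Fin n → ℕ) → ℝ≥0∞
  | 0, _, R, S => ∑' N : Fin n → ℕ,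
      ENNReal.ofReal (2 * ħ) ^ (mdeg R + mdeg S + mdeg N) / (mfact N : ℝ≥0∞) *
        ‖jet p R (N + S) f‖ₑ ^ 2
  | m + 1, l, R, S =>
      if Even l then hStep (fun I J => hph p ħ f m (l / 2) I J) R S
      else hStep (fun I J => hph p ħ f m ((l - 1) / 2) J I) R S

/-- The extended seminorm `‖f‖_{m,ℓ,R,S} = h_{m,ℓ,R,S}(f)^{1/2^{m+1}} ∈ [0,∞]`. -/
noncomputable def normph {n : ℕ} (p : Fin n → ℂ) (ħ : ℝ) (m l : ℕ) (R S : Fin n → ℕ)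
    (f : Smooth n) : ℝ≥0∞ :=
  hph p ħ f m l R S ^ (1 / (2 : ℝ) ^ (m + 1))

section aux

theorem tsum_cs {ι : Type} (a b c : ι → ℝ≥0∞) (h : ∀ i, c i ^ 2 ≤ a i * b i) :
    (∑' i, c i) ^ 2 ≤ (∑' i, a i) * ∑' i, b i := by
  let _ : MeasurableSpace ι := ⊤
  have hc : ∀ i, c i ≤ a i ^ (1 / 2 : ℝ) * b i ^ (1 / 2 : ℝ) := by
    intro i
    rw [← ENNReal.mul_rpow_of_nonneg _ _ (by norm_num), one_div,
      ENNReal.le_rpow_inv_iff (by norm_num)]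
    simpa using h i
  have hH : (2 : ℝ).HolderConjugate 2 := Real.HolderConjugate.two_two
  have := ENNReal.lintegral_mul_le_Lp_mul_Lq (MeasureTheory.Measure.count (α := ι)) hH
    (f := fun i => a i ^ (1 / 2 : ℝ)) (g := fun i => b i ^ (1 / 2 : ℝ))
    (measurable_from_top.aemeasurable) (measurable_from_top.aemeasurable)
  simp only [MeasureTheory.lintegral_count, Pi.mul_apply] at this
  have e : ∀ x : ℝ≥0∞, (x ^ (1 / 2 : ℝ)) ^ (2 : ℝ) = x := by
    intro x; rw [← ENNReal.rpow_mul]; norm_num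
  simp only [e] at this
  have h2 := (ENNReal.tsum_le_tsum hc).trans this
  rw [← ENNReal.mul_rpow_of_nonneg _ _ (by norm_num), one_div,
    ENNReal.le_rpow_inv_iff (by norm_num)] at h2
  simpa using h2

theorem sum_cs {ι : Type} (s : Finset ι) (a b c : ι → ℝ≥0∞) (h : ∀ i ∈ s, c i ^ 2 ≤ a i * b i) :
    (∑ i ∈ s, c i) ^ 2 ≤ (∑ i ∈ s, a i) * ∑ i ∈ s, b i := by
  have := tsum_cs (fun i : s => a i) (fun i : s => b i) (fun i : s => c i) (fun i => h i i.2)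
  simpa only [Finset.tsum_subtype] using this

theorem tsum_mink {ι : Type} {q : ℝ} (hq : 1 ≤ q) (a b c : ι → ℝ≥0∞)
    (h : ∀ i, c i ^ (1 / q) ≤ a i ^ (1 / q) + b i ^ (1 / q)) :
    (∑' i, c i) ^ (1 / q) ≤ (∑' i, a i) ^ (1 / q) + (∑' i, b i) ^ (1 / q) := by
  let _ : MeasurableSpace ι := ⊤
  have q0 : 0 < q := by linarith
  have e : ∀ x : ℝ≥0∞, (x ^ (1 / q)) ^ q = x := by
    intro x; rw [← ENNReal.rpow_mul]; field_simp; simp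
  have hc : ∀ i, c i ≤ (a i ^ (1 / q) + b i ^ (1 / q)) ^ q := by
    intro i
    rw [← e (c i)]
    exact ENNReal.rpow_le_rpow (h i) q0.le
  have := ENNReal.lintegral_Lp_add_le (μ := MeasureTheory.Measure.count (α := ι))
    (f := fun i => a i ^ (1 / q)) (g := fun i => b i ^ (1 / q))
    (measurable_from_top.aemeasurable) (measurable_from_top.aemeasurable) hq
  simp only [MeasureTheory.lintegral_count, Pi.add_apply, e] at this
  exact (ENNReal.rpow_le_rpow (ENNReal.tsum_le_tsum hc) (by positivity)).trans this

theorem sum_mink {ι : Type} {q : ℝ} (hq : 1 ≤ q) (s : Finset ι) (a b c : ι → ℝ≥0∞)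
    (h : ∀ i ∈ s, c i ^ (1 / q) ≤ a i ^ (1 / q) + b i ^ (1 / q)) :
    (∑ i ∈ s, c i) ^ (1 / q) ≤ (∑ i ∈ s, a i) ^ (1 / q) + (∑ i ∈ s, b i) ^ (1 / q) := by
  have := tsum_mink hq (fun i : s => a i) (fun i : s => b i) (fun i : s => c i)
    (fun i => h i i.2)
  simpa only [Finset.tsum_subtype] using this

theorem scale_mink {q : ℝ} (hq : 1 ≤ q) {w a b c : ℝ≥0∞}
    (h : c ^ (1 / q) ≤ a ^ (1 / q) + b ^ (1 / q)) :
    (w * c) ^ (1 / q) ≤ (w * a) ^ (1 / q) + (w * b) ^ (1 / q) := by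
  have : 0 ≤ 1 / q := by positivity
  simp only [ENNReal.mul_rpow_of_nonneg _ _ this, ← mul_add]
  gcongr

theorem scale_cs {w a b c : ℝ≥0∞} (h : c ^ 2 ≤ a * b) : (w * c) ^ 2 ≤ (w * a) * (w * b) := by
  rw [mul_pow, mul_mul_mul_comm, pow_two w]
  gcongr

end aux

section step
variable {n : ℕ}

theorem hStep_mono {H K : (Fin n → ℕ) → (Fin n → ℕ) → ℝ≥0∞} (h : ∀ I J, H I J ≤ K I J)
    (R S : Fin n → ℕ) : hStep H R S ≤ hStep K R S := by
  unfold hStep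
  gcongr with N I _ J _
  exact h I J

theorem hStep_const_mul (c : ℝ≥0∞) (H : (Fin n → ℕ) → (Fin n → ℕ) → ℝ≥0∞) (R S : Fin n → ℕ) :
    hStep (fun I J => c * H I J) R S = c ^ 2 * hStep H R S := by
  unfold hStep
  rw [← ENNReal.tsum_mul_left]
  congr 1; ext N
  have : ∑ I ∈ Iic R, ∑ J ∈ Iic (N + S),
      (mchoose R I : ℝ≥0∞) * (mchoose (N + S) J : ℝ≥0∞) * (c * H I J) =
      c * ∑ I ∈ Iic R, ∑ J ∈ Iic (N + S),
      (mchoose R I : ℝ≥0∞) * (mchoose (N + S) J : ℝ≥0∞) * H I J := by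
    simp only [Finset.mul_sum]
    refine sum_congr rfl fun I _ => sum_congr rfl fun J _ => by ring
  rw [this]; ring

theorem hStep_cs {H K L : (Fin n → ℕ) → (Fin n → ℕ) → ℝ≥0∞}
    (h : ∀ I J, L I J ^ 2 ≤ H I J * K I J) (R S : Fin n → ℕ) :
    hStep L R S ^ 2 ≤ hStep H R S * hStep K R S := by
  unfold hStep
  apply tsum_cs
  intro N
  apply scale_cs
  rw [← mul_pow]
  gcongr
  apply sum_cs
  intro I _
  apply sum_cs
  intro J _
  exact scale_cs (h I J)

theorem hStep_mink {q : ℝ} (hq : 1 ≤ q) {H K L : (Fin n → ℕ) → (Fin n → ℕ) → ℝ≥0∞}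
    (h : ∀ I J, L I J ^ (1 / q) ≤ H I J ^ (1 / q) + K I J ^ (1 / q)) (R S : Fin n → ℕ) :
    hStep L R S ^ (1 / (2 * q)) ≤ hStep H R S ^ (1 / (2 * q)) + hStep K R S ^ (1 / (2 * q)) := by
  unfold hStep
  have h2 : 1 ≤ 2 * q := by linarith
  apply tsum_mink h2
  intro N
  apply scale_mink h2
  have e : ∀ x : ℝ≥0∞, (x ^ 2) ^ (1 / (2 * q)) = x ^ (1 / q) := by
    intro x
    rw [← ENNReal.rpow_natCast, ← ENNReal.rpow_mul]
    congr 1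
    field_simp
    norm_num
  simp only [e]
  apply sum_mink hq
  intro I _
  apply sum_mink hq
  intro J _
  exact scale_mink hq (h I J)

theorem mchoose_le_succ (R I : Fin n → ℕ) (i : Fin n) :
    mchoose R I ≤ mchoose (R + Pi.single i 1) (I + Pi.single i 1) := by
  rw [mchoose_succ]; omega

theorem sum_shift_le (R : Fin n → ℕ) (i : Fin n) (F : (Fin n → ℕ) → ℝ≥0∞) :
    ∑ I ∈ Iic R, (mchoose R I : ℝ≥0∞) * F (I + Pi.single i 1) ≤
      ∑ I ∈ Iic (R + Pi.single i 1), (mchoose (R + Pi.single i 1) I : ℝ≥0∞) * F I := by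
  have := sum_mchoose_succ R i F
  simp only [nsmul_eq_mul] at this
  rw [this]
  exact le_add_self

theorem hStep_shift_left (H : (Fin n → ℕ) → (Fin n → ℕ) → ℝ≥0∞) (R S : Fin n → ℕ) (i : Fin n) :
    hStep (fun I J => H (I + Pi.single i 1) J) R S ≤ hStep H (R + Pi.single i 1) S := by
  unfold hStep
  gcongr with N
  simp only [mul_assoc, ← Finset.mul_sum]
  exact sum_shift_le R i fun I => ∑ J ∈ Iic (N + S), (mchoose (N + S) J : ℝ≥0∞) * H I J

theorem hStep_shift_right (H : (Fin n → ℕ) → (Fin n → ℕ) → ℝ≥0∞) (R S : Fin n → ℕ) (i : Fin n) :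
    hStep (fun I J => H I (J + Pi.single i 1)) R S ≤ hStep H R (S + Pi.single i 1) := by
  unfold hStep
  gcongr with N
  simp only [mul_assoc, ← Finset.mul_sum]
  gcongr with I
  rw [← add_assoc]
  exact sum_shift_le (N + S) i fun J => H I J

/-! Finiteness on functions with geometrically bounded jets. -/

theorem mdeg_add_single (R : Fin n → ℕ) (i : Fin n) : mdeg (R + Pi.single i 1) = mdeg R + 1 := by
  simp [mdeg, sum_add_distrib]

theorem sum_mchoose_pow (a : ℝ≥0∞) (R : Fin n → ℕ) :
    ∑ I ∈ Iic R, (mchoose R I : ℝ≥0∞) * a ^ mdeg I = (1 + a) ^ mdeg R := by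
  induction R using multi_induction with
  | h0 =>
    have : (Iic (0 : Fin n → ℕ)) = {0} := by
      ext I; simp
    rw [this]
    simp [mchoose, mdeg]
  | hs R i ih =>
    have := sum_mchoose_succ R i (fun I => a ^ mdeg I)
    simp only [nsmul_eq_mul, mdeg_add_single, pow_succ, ← mul_assoc, ← Finset.sum_mul, ih] at this
    rw [this, mdeg_add_single]
    ring

theorem mdeg_add (R S : Fin n → ℕ) : mdeg (R + S) = mdeg R + mdeg S := by
  simp [mdeg, sum_add_distrib]

theorem tsum_exp_lt_top {x : ℝ≥0∞} (hx : x < ⊤) :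
    ∑' k : ℕ, (k ! : ℝ≥0∞)⁻¹ * x ^ k < ⊤ := by
  lift x to NNReal using hx.ne
  have h := NNReal.summable_coe.1 (by simpa using Real.summable_pow_div_factorial (x : ℝ)
    : Summable fun k : ℕ => (((x ^ k / (k ! : NNReal) : NNReal)) : ℝ))
  have : ∀ k : ℕ, (k ! : ℝ≥0∞)⁻¹ * (x : ℝ≥0∞) ^ k = ((x ^ k / (k ! : NNReal) : NNReal) : ℝ≥0∞) := by
    intro k
    rw [ENNReal.coe_div (by positivity)]
    push_cast
    rw [ENNReal.div_eq_inv_mul]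
  simp only [this]
  exact (ENNReal.tsum_coe_ne_top_iff_summable.2 h).lt_top

theorem tsum_mexp_lt_top {x : ℝ≥0∞} (hx : x < ⊤) :
    ∀ n : ℕ, ∑' N : Fin n → ℕ, (mfact N : ℝ≥0∞)⁻¹ * x ^ mdeg N < ⊤ := by
  intro n
  induction n with
  | zero =>
    simp [mfact, mdeg]
  | succ n ih =>
    rw [← (Fin.consEquiv (fun _ : Fin (n + 1) => ℕ)).tsum_eq, ENNReal.tsum_prod']
    have : ∀ (k : ℕ) (N : Fin n → ℕ),
        (mfact (Fin.consEquiv (fun _ : Fin (n + 1) => ℕ) (k, N)) : ℝ≥0∞)⁻¹ *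
          x ^ mdeg (Fin.consEquiv (fun _ : Fin (n + 1) => ℕ) (k, N)) =
        ((k ! : ℝ≥0∞)⁻¹ * x ^ k) * ((mfact N : ℝ≥0∞)⁻¹ * x ^ mdeg N) := by
      intro k N
      simp only [mfact, mdeg, Fin.consEquiv_apply, Fin.prod_univ_succ, Fin.sum_univ_succ,
        Fin.cons_zero, Fin.cons_succ]
      push_cast
      rw [pow_add, ENNReal.mul_inv (by left; positivity) (by left; finiteness)]
      ring
    simp only [this, ENNReal.tsum_mul_left, ENNReal.tsum_mul_right]
    exact ENNReal.mul_lt_top (tsum_exp_lt_top hx) ih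

theorem hStep_geom (a b c : ℝ≥0∞) (R S : Fin n → ℕ) :
    hStep (fun I J => c * a ^ mdeg I * b ^ mdeg J) R S =
      (c ^ 2 * ∑' N : Fin n → ℕ, (mfact N : ℝ≥0∞)⁻¹ * ((1 + b) ^ 2) ^ mdeg N) *
        ((1 + a) ^ 2) ^ mdeg R * ((1 + b) ^ 2) ^ mdeg S := by
  unfold hStep
  have : ∀ N, ∑ I ∈ Iic R, ∑ J ∈ Iic (N + S),
      (mchoose R I : ℝ≥0∞) * (mchoose (N + S) J : ℝ≥0∞) * (c * a ^ mdeg I * b ^ mdeg J) =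
      c * (1 + a) ^ mdeg R * (1 + b) ^ mdeg (N + S) := by
    intro N
    rw [← sum_mchoose_pow a R, ← sum_mchoose_pow b, mul_assoc, Finset.sum_mul_sum, Finset.mul_sum]
    refine sum_congr rfl fun I _ => ?_
    rw [Finset.mul_sum]
    refine sum_congr rfl fun J _ => by ring
  simp only [this, mdeg_add]
  rw [← ENNReal.tsum_mul_left, ← ENNReal.tsum_mul_right, ← ENNReal.tsum_mul_right]
  congr 1; ext N
  simp only [pow_add, mul_pow, ← pow_mul]
  ring

end step

section props
variable {n : ℕ} (p : Fin n → ℂ) (ħ : ℝ)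

theorem jet_smul (I J : Fin n → ℕ) (c : ℂ) (f : Smooth n) : jet p I J (c • f) = c * jet p I J f := by
  simp [jet]

theorem jet_add (I J : Fin n → ℕ) (f g : Smooth n) :
    jet p I J (f + g) = jet p I J f + jet p I J g := by
  simp [jet]

theorem jet_mul (R S : Fin n → ℕ) (f g : Smooth n) :
    jet p R S (f * g) = ∑ I ∈ Iic R, ∑ J ∈ Iic S,
      ((mchoose R I : ℂ) * (mchoose S J : ℂ)) * (jet p I J f * jet p (R - I) (S - J) g) := by
  unfold jet
  rw [dzbarPow_mul, map_sum, Finset.sum_comm]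
  simp only [map_nsmul, dzPow_mul, AddSubmonoidClass.coe_finsetSum, Finset.sum_apply,
    Finset.smul_sum]
  refine sum_congr rfl fun J _ => sum_congr rfl fun I _ => ?_
  simp
  ring

theorem jet_dz (I J : Fin n → ℕ) (i : Fin n) (f : Smooth n) :
    jet p I J (dz i f) = jet p (I + Pi.single i 1) J f := by
  rw [jet, jet, dzbarPow_dz, dzPow_add_single]

theorem jet_dzbar (I J : Fin n → ℕ) (i : Fin n) (f : Smooth n) :
    jet p I J (dzbar i f) = jet p I (J + Pi.single i 1) f := by
  rw [jet, jet, dzbarPow_add_single]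

theorem hph_congr {f g : Smooth n} (h : ∀ I J, jet p I J f = jet p I J g) (m l : ℕ) :
    ∀ R S, hph p ħ f m l R S = hph p ħ g m l R S := by
  induction m generalizing l with
  | zero => intro R S; simp only [hph, h]
  | succ m ih =>
    intro R S
    simp only [hph, ih]

theorem hph_smul (c : ℂ) (f : Smooth n) (m l : ℕ) :
    ∀ R S, hph p ħ (c • f) m l R S = ‖c‖ₑ ^ (2 ^ (m + 1)) * hph p ħ f m l R S := by
  induction m generalizing l with
  | zero =>
    intro R S
    simp only [hph, jet_smul, enorm_mul]
    rw [← ENNReal.tsum_mul_left]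
    congr 1; ext N
    ring
  | succ m ih =>
    intro R S
    simp only [hph, ih, hStep_const_mul]
    rw [← pow_mul, ← pow_succ]
    split_ifs <;> rfl

theorem hph_add (f g : Smooth n) (m l : ℕ) :
    ∀ R S, hph p ħ (f + g) m l R S ^ (1 / (2 : ℝ) ^ (m + 1)) ≤
      hph p ħ f m l R S ^ (1 / (2 : ℝ) ^ (m + 1)) + hph p ħ g m l R S ^ (1 / (2 : ℝ) ^ (m + 1)) := by
  induction m generalizing l with
  | zero =>
    intro R S
    simp only [hph]
    have h2 : (1 : ℝ) ≤ 2 ^ (0 + 1) := by norm_num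
    apply tsum_mink h2
    intro N
    apply scale_mink h2
    have e : ∀ x : ℝ≥0∞, (x ^ 2) ^ (1 / (2 : ℝ) ^ (0 + 1)) = x := by
      intro x
      rw [← ENNReal.rpow_natCast, ← ENNReal.rpow_mul]
      norm_num
    simp only [e, jet_add]
    exact enorm_add_le _ _
  | succ m ih =>
    intro R S
    have h1 : (1 : ℝ) ≤ 2 ^ (m + 1) := one_le_pow₀ (by norm_num)
    rw [pow_succ' (2 : ℝ) (m + 1)]
    simp only [hph]
    split_ifs
    · exact hStep_mink h1 (fun I J => ih _ I J) R S
    · exact hStep_mink h1 (fun I J => ih _ J I) R S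

theorem mul_jet_le (f : Smooth n) (R S : Fin n → ℕ) :
    ENNReal.ofReal (2 * ħ) ^ (mdeg R + mdeg S) * ‖jet p R S f‖ₑ ^ 2 ≤ hph p ħ f 0 0 R S := by
  simp only [hph]
  refine le_trans (le_of_eq ?_) (ENNReal.le_tsum 0)
  simp [mdeg, mfact]

theorem sum_mchoose_symm (R : Fin n → ℕ) (F : (Fin n → ℕ) → ℝ≥0∞) :
    ∑ I ∈ Iic R, (mchoose R I : ℝ≥0∞) * F (R - I) = ∑ I ∈ Iic R, (mchoose R I : ℝ≥0∞) * F I := by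
  refine Finset.sum_bij' (fun I _ => R - I) (fun I _ => R - I) ?_ ?_ ?_ ?_ ?_
  · intro I _; simp
  · intro I _; simp
  · intro I hI; exact tsub_tsub_cancel_of_le (mem_Iic.1 hI)
  · intro I hI; exact tsub_tsub_cancel_of_le (mem_Iic.1 hI)
  · intro I hI
    have : mchoose R (R - I) = mchoose R I :=
      Finset.prod_congr rfl fun j _ => Nat.choose_symm (mem_Iic.1 hI j)
    rw [this]

theorem hph_mul (f g : Smooth n) (m l : ℕ) (hl : l < 2 ^ m) :
    ∀ R S, hph p ħ (f * g) m l R S ^ 2 ≤ hph p ħ f (m + 1) l R S * hph p ħ g (m + 1) l R S := by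
  induction m generalizing l with
  | zero =>
    intro R S
    obtain rfl : l = 0 := by simpa using hl
    have key : ∀ f : Smooth n, hph p ħ f (0 + 1) 0 R S =
        hStep (fun I J => hph p ħ f 0 0 I J) R S := by
      intro f
      rw [hph]
      simp
    rw [key, key, hph]
    unfold hStep
    apply tsum_cs
    intro N
    rw [div_eq_mul_inv, mul_comm (ENNReal.ofReal _ ^ _), mul_assoc]
    apply scale_cs
    rw [← mul_pow]
    refine pow_le_pow_left₀ bot_le ?_ 2
    beta_reduce
    have hnat : ∀ k : ℕ, ‖(k : ℂ)‖ₑ = (k : ℝ≥0∞) := by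
      intro k
      rw [enorm_eq_nnnorm, Complex.nnnorm_natCast]
      rfl
    obtain ⟨s, hs⟩ : ∃ s : ℝ≥0∞, s ^ 2 = ENNReal.ofReal (2 * ħ) := by
      refine ⟨ENNReal.ofReal (2 * ħ) ^ (1 / 2 : ℝ), ?_⟩
      rw [← ENNReal.rpow_natCast, ← ENNReal.rpow_mul]
      norm_num
    have symm2 : ∑ I ∈ Iic R, ∑ J ∈ Iic (N + S), (mchoose R I : ℝ≥0∞) *
        (mchoose (N + S) J : ℝ≥0∞) * hph p ħ g 0 0 I J =
        ∑ I ∈ Iic R, ∑ J ∈ Iic (N + S), (mchoose R I : ℝ≥0∞) *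
        (mchoose (N + S) J : ℝ≥0∞) * hph p ħ g 0 0 (R - I) (N + S - J) := by
      simp only [mul_assoc, ← Finset.mul_sum]
      rw [← sum_mchoose_symm R]
      refine sum_congr rfl fun I _ => ?_
      rw [sum_mchoose_symm (N + S) (fun J => hph p ħ g 0 0 (R - I) J)]
    calc _ = (s ^ (mdeg R + mdeg S + mdeg N) * ‖jet p R (N + S) (f * g)‖ₑ) ^ 2 := by
            rw [← hs, mul_pow, ← pow_mul, ← pow_mul, mul_comm 2]
      _ ≤ (∑ I ∈ Iic R, ∑ J ∈ Iic (N + S), (mchoose R I : ℝ≥0∞) * (mchoose (N + S) J : ℝ≥0∞) *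
            (s ^ (mdeg R + mdeg S + mdeg N) *
              (‖jet p I J f‖ₑ * ‖jet p (R - I) (N + S - J) g‖ₑ))) ^ 2 := by
            gcongr
            rw [jet_mul]
            refine (mul_le_mul_right ((enorm_sum_le _ _).trans
              (sum_le_sum fun I _ => enorm_sum_le _ _)) _).trans (le_of_eq ?_)
            simp only [Finset.mul_sum, enorm_mul, hnat]
            refine sum_congr rfl fun I _ => sum_congr rfl fun J _ => ?_
            ring
      _ ≤ _ := by
            rw [symm2]
            apply sum_cs
            intro I hI
            apply sum_cs
            intro J hJ
            apply scale_cs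
            refine le_trans (le_of_eq ?_) (mul_le_mul' (mul_jet_le p ħ f I J)
              (mul_jet_le p ħ g (R - I) (N + S - J)))
            have h1 : mdeg R = mdeg I + mdeg (R - I) := by
              rw [← mdeg_add, add_tsub_cancel_of_le (mem_Iic.1 hI)]
            have h2 : mdeg N + mdeg S = mdeg J + mdeg (N + S - J) := by
              rw [← mdeg_add, ← mdeg_add, add_tsub_cancel_of_le (mem_Iic.1 hJ)]
            have h3 : mdeg R + mdeg S + mdeg N =
              mdeg I + mdeg (R - I) + (mdeg J + mdeg (N + S - J)) := by omega
            rw [h3, ← hs]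
            ring
  | succ m ih =>
    intro R S
    rw [hph.eq_def p ħ (f * g), hph.eq_def p ħ f, hph.eq_def p ħ g]
    simp only
    split_ifs
    · exact hStep_cs (fun I J => ih _ (by omega) I J) R S
    · exact hStep_cs (fun I J => ih _ (by omega) J I) R S

/-- Partial derivatives shift one of the two indices of `h_{m,ℓ,R,S}`. -/
theorem hph_shift [hħ : Fact (0 < ħ)] (f g : Smooth n) (i : Fin n) (m l : ℕ)
    (h : (∀ I J, jet p I J g = jet p (I + Pi.single i 1) J f) ∨
      (∀ I J, jet p I J g = jet p I (J + Pi.single i 1) f)) :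
    ∃ c : ℝ≥0∞, c < ⊤ ∧
      ((∀ R S, hph p ħ g m l R S ≤ c * hph p ħ f m l (R + Pi.single i 1) S) ∨
        (∀ R S, hph p ħ g m l R S ≤ c * hph p ħ f m l R (S + Pi.single i 1))) := by
  induction m generalizing l with
  | zero =>
    have h0 : ENNReal.ofReal (2 * ħ) ≠ 0 := by
      have := hħ.out
      simpa using this
    have e : ∀ (k : ℕ) (y : ℝ≥0∞), ENNReal.ofReal (2 * ħ) ^ k * y =
        (ENNReal.ofReal (2 * ħ))⁻¹ * (ENNReal.ofReal (2 * ħ) ^ (k + 1) * y) := by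
      intro k y
      rw [pow_succ', ← mul_assoc, ← mul_assoc, ENNReal.inv_mul_cancel h0 (by finiteness), one_mul]
    refine ⟨(ENNReal.ofReal (2 * ħ))⁻¹, ENNReal.inv_lt_top.2 (by positivity), ?_⟩
    refine h.imp ?_ ?_
    · intro h R S
      simp only [hph, h, ← ENNReal.tsum_mul_left]
      refine ENNReal.tsum_le_tsum fun N => le_of_eq ?_
      rw [mdeg_add_single, div_eq_mul_inv, mul_assoc, e, div_eq_mul_inv, mul_assoc,
        show mdeg R + 1 + mdeg S + mdeg N = mdeg R + mdeg S + mdeg N + 1 by ring]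
    · intro h R S
      simp only [hph, h, ← ENNReal.tsum_mul_left]
      refine ENNReal.tsum_le_tsum fun N => le_of_eq ?_
      rw [mdeg_add_single, div_eq_mul_inv, mul_assoc, e, div_eq_mul_inv, mul_assoc,
        show mdeg R + (mdeg S + 1) + mdeg N = mdeg R + mdeg S + mdeg N + 1 by ring, add_assoc N]
  | succ m ih =>
    rcases Nat.even_or_odd l with hl | hl
    · obtain ⟨c, hc, hh⟩ := ih (l / 2)
      refine ⟨c ^ 2, by finiteness, hh.imp ?_ ?_⟩
      · intro hh R S
        simp only [hph, hl, if_true]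
        refine (hStep_mono (fun I J => hh I J) R S).trans ?_
        rw [hStep_const_mul]
        gcongr
        exact hStep_shift_left (fun I J => hph p ħ f m (l / 2) I J) R S i
      · intro hh R S
        simp only [hph, hl, if_true]
        refine (hStep_mono (fun I J => hh I J) R S).trans ?_
        rw [hStep_const_mul]
        gcongr
        exact hStep_shift_right (fun I J => hph p ħ f m (l / 2) I J) R S i
    · obtain ⟨c, hc, hh⟩ := ih ((l - 1) / 2)
      rw [← Nat.not_even_iff_odd] at hl
      refine ⟨c ^ 2, by finiteness, hh.symm.imp ?_ ?_⟩
      · intro hh R S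
        simp only [hph, hl, if_false]
        refine (hStep_mono (fun I J => hh J I) R S).trans ?_
        rw [hStep_const_mul]
        gcongr
        exact hStep_shift_left (fun I J => hph p ħ f m ((l - 1) / 2) J I) R S i
      · intro hh R S
        simp only [hph, hl, if_false]
        refine (hStep_mono (fun I J => hh J I) R S).trans ?_
        rw [hStep_const_mul]
        gcongr
        exact hStep_shift_right (fun I J => hph p ħ f m ((l - 1) / 2) J I) R S i

/-- Functions with geometrically bounded jets have finite seminorms. -/
theorem hph_lt_top_of_geom (f : Smooth n) {a b c : ℝ≥0∞} (ha : a < ⊤) (hb : b < ⊤) (hc : c < ⊤)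
    (h : ∀ I J, ‖jet p I J f‖ₑ ≤ c * a ^ mdeg I * b ^ mdeg J) (m l : ℕ) (R S : Fin n → ℕ) :
    hph p ħ f m l R S < ⊤ := by
  suffices H : ∃ a b c : ℝ≥0∞, a < ⊤ ∧ b < ⊤ ∧ c < ⊤ ∧
      ∀ R S, hph p ħ f m l R S ≤ c * a ^ mdeg R * b ^ mdeg S by
    obtain ⟨a, b, c, ha, hb, hc, h⟩ := H
    exact (h R S).trans_lt (by finiteness)
  clear R S
  induction m generalizing l with
  | zero =>
    set X := ENNReal.ofReal (2 * ħ) with hX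
    have hXt : X < ⊤ := by finiteness
    refine ⟨X * a ^ 2, X * b ^ 2,
      c ^ 2 * ∑' N : Fin n → ℕ, (mfact N : ℝ≥0∞)⁻¹ * (X * b ^ 2) ^ mdeg N, by finiteness,
      by finiteness, ENNReal.mul_lt_top (by finiteness) (tsum_mexp_lt_top (by finiteness) n), ?_⟩
    intro R S
    simp only [hph]
    rw [← ENNReal.tsum_mul_left, ← ENNReal.tsum_mul_right, ← ENNReal.tsum_mul_right]
    refine ENNReal.tsum_le_tsum fun N => ?_
    rw [← hX, div_eq_mul_inv]
    calc _ ≤ X ^ (mdeg R + mdeg S + mdeg N) * (mfact N : ℝ≥0∞)⁻¹ *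
          (c * a ^ mdeg R * b ^ mdeg (N + S)) ^ 2 := by gcongr; exact h _ _
      _ = _ := by rw [mdeg_add]; ring
  | succ m ih =>
    rcases Nat.even_or_odd l with hl | hl
    · obtain ⟨a, b, c, ha, hb, hc, hh⟩ := ih (l / 2)
      refine ⟨(1 + a) ^ 2, (1 + b) ^ 2, _, by finiteness, by finiteness,
        ENNReal.mul_lt_top (by finiteness : c ^ 2 < ⊤)
          (tsum_mexp_lt_top (by finiteness : (1 + b) ^ 2 < ⊤) n), ?_⟩
      intro R S
      simp only [hph, hl, if_true]
      rw [← hStep_geom]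
      exact hStep_mono (fun I J => hh I J) R S
    · obtain ⟨a, b, c, ha, hb, hc, hh⟩ := ih ((l - 1) / 2)
      rw [← Nat.not_even_iff_odd] at hl
      refine ⟨(1 + b) ^ 2, (1 + a) ^ 2, _, by finiteness, by finiteness,
        ENNReal.mul_lt_top (by finiteness : c ^ 2 < ⊤)
          (tsum_mexp_lt_top (by finiteness : (1 + a) ^ 2 < ⊤) n), ?_⟩
      intro R S
      simp only [hph, hl, if_false]
      rw [← hStep_geom]
      refine hStep_mono (fun I J => ?_) R S
      calc _ ≤ _ := hh J I
        _ = _ := by ring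

end props

/-! The Fréchet space `A_{p,ħ}` and the Wick product. -/

section space
variable {n : ℕ} (p : Fin n → ℂ) (ħ : ℝ)

theorem normph_lt_top_iff (m l : ℕ) (R S : Fin n → ℕ) (f : Smooth n) :
    normph p ħ m l R S f < ⊤ ↔ hph p ħ f m l R S < ⊤ :=
  ENNReal.rpow_lt_top_iff_of_pos (by positivity)

theorem jet_zero (I J : Fin n → ℕ) : jet p I J (0 : Smooth n) = 0 := by
  simp [jet]

theorem eq_zero_or_exists_add_single (I : Fin n → ℕ) : I = 0 ∨ ∃ (K : Fin n → ℕ) (i : Fin n), I = K + Pi.single i 1 := by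
  induction I using multi_induction with
  | h0 => exact Or.inl rfl
  | hs R i _ => exact Or.inr ⟨R, i, rfl⟩

theorem enorm_jet_const_le (c : ℂ) (I J : Fin n → ℕ) :
    ‖jet p I J (algebraMap ℂ (Smooth n) c)‖ₑ ≤ ‖c‖ₑ := by
  rcases eq_zero_or_exists_add_single J with rfl | ⟨K, i, rfl⟩
  · rcases eq_zero_or_exists_add_single I with rfl | ⟨K, i, rfl⟩
    · simp only [jet, dzPow, dzbarPow, multiPow_zero]
      exact le_rfl
    · rw [← jet_dz, Derivation.map_algebraMap, jet_zero]; simp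
  · rw [← jet_dzbar, Derivation.map_algebraMap, jet_zero]; simp

/-- The space of smooth functions on `ℂⁿ` for which all `‖f‖_{m,ℓ,R,S}` with `0 ≤ ℓ ≤ 2^m - 1`
are finite. (It is a subalgebra of `C^∞(ℂⁿ)`.) -/
noncomputable def tildeA : Subalgebra ℂ (Smooth n) where
  carrier := {f | ∀ m l : ℕ, l < 2 ^ m → ∀ R S, normph p ħ m l R S f < ⊤}
  add_mem' {f g} hf hg := by
    intro m l hl R S
    exact (hph_add p ħ f g m l R S).trans_lt (ENNReal.add_lt_top.2 ⟨hf m l hl R S, hg m l hl R S⟩)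
  mul_mem' {f g} hf hg := by
    intro m l hl R S
    rw [normph_lt_top_iff]
    have hl' : l < 2 ^ (m + 1) := by rw [pow_succ]; omega
    have h1 := (normph_lt_top_iff p ħ _ _ _ _ _).1 (hf (m + 1) l hl' R S)
    have h2 := (normph_lt_top_iff p ħ _ _ _ _ _).1 (hg (m + 1) l hl' R S)
    have := (hph_mul p ħ f g m l hl R S).trans_lt (ENNReal.mul_lt_top h1 h2)
    simpa using this
  algebraMap_mem' c := by
    intro m l _ R S
    rw [normph_lt_top_iff]
    exact hph_lt_top_of_geom p ħ _ (a := 1) (b := 1) (c := ‖c‖ₑ) (by simp) (by simp) (by simp)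
      (fun I J => by simpa using enorm_jet_const_le p c I J) m l R S

noncomputable instance : CommRing (tildeA p ħ) := Subalgebra.toCommRing (tildeA p ħ)

noncomputable instance : Algebra ℂ (tildeA p ħ) := Subalgebra.algebra (tildeA p ħ)

/-- The ideal of functions whose `∞`-jet at `p` vanishes. -/
noncomputable def flatIdeal : Ideal (tildeA p ħ) where
  carrier := {f | ∀ I J, jet p I J (f : Smooth n) = 0}
  zero_mem' := fun I J => jet_zero p I J
  add_mem' {f g} hf hg := by
    intro I J
    have := jet_add p I J (f : Smooth n) (g : Smooth n)
    rw [hf I J, hg I J, add_zero] at this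
    exact this
  smul_mem' f g hg := by
    intro I J
    have := jet_mul p I J (f : Smooth n) (g : Smooth n)
    refine this.trans (sum_eq_zero fun K _ => sum_eq_zero fun L _ => ?_)
    rw [hg, mul_zero, mul_zero]

theorem mem_flatIdeal {f : tildeA p ħ} :
    f ∈ flatIdeal p ħ ↔ ∀ I J, jet p I J (f : Smooth n) = 0 := Iff.rfl

/-- The space `A_{p,ħ}`: the functions with finite seminorms, modulo those with vanishing `∞`-jet
at `p`. Its ring structure is the one of the *pointwise* product. -/
def Aph : Type := tildeA p ħ ⧸ flatIdeal p ħ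

noncomputable instance : CommRing (Aph p ħ) :=
  inferInstanceAs (CommRing (tildeA p ħ ⧸ flatIdeal p ħ))

noncomputable instance : Algebra ℂ (Aph p ħ) :=
  inferInstanceAs (Algebra ℂ (tildeA p ħ ⧸ flatIdeal p ħ))

/-- The class in `A_{p,ħ}` of a function. -/
noncomputable def toAph : tildeA p ħ →ₐ[ℂ] Aph p ħ := Ideal.Quotient.mkₐ ℂ (flatIdeal p ħ)

theorem toAph_surjective : Function.Surjective (toAph p ħ) :=
  Ideal.Quotient.mkₐ_surjective ℂ (flatIdeal p ħ)

theorem toAph_eq_iff {f g : tildeA p ħ} : toAph p ħ f = toAph p ħ g ↔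
    ∀ I J, jet p I J (f : Smooth n) = jet p I J (g : Smooth n) := by
  refine Ideal.Quotient.eq.trans ((mem_flatIdeal p ħ).trans ?_)
  refine forall₂_congr fun I J => ?_
  have : jet p I J ((f - g : tildeA p ħ) : Smooth n) = jet p I J f - jet p I J g := by
    simp [jet]
  rw [this, sub_eq_zero]

/-- The seminorm `‖·‖_{m,ℓ,R,S}` on functions with finite seminorms. -/
noncomputable def seminormTilde (m : ℕ) (l : Fin (2 ^ m)) (R S : Fin n → ℕ) :
    Seminorm ℂ (tildeA p ħ) :=
  Seminorm.of (fun f => (normph p ħ m l R S (f : Smooth n)).toReal)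
    (fun f g => by
      rw [← ENNReal.toReal_add (f.2 m l l.2 R S).ne (g.2 m l l.2 R S).ne]
      exact ENNReal.toReal_mono
        (ENNReal.add_lt_top.2 ⟨f.2 m l l.2 R S, g.2 m l l.2 R S⟩).ne
        (hph_add p ħ f g m l R S))
    (fun c f => by
      have : normph p ħ m l R S ((c • f : tildeA p ħ) : Smooth n) =
          ‖c‖ₑ * normph p ħ m l R S (f : Smooth n) := by
        have e := hph_smul p ħ c (f : Smooth n) m l R S
        change hph p ħ (c • (f : Smooth n)) m l R S ^ _ = _
        rw [e, ENNReal.mul_rpow_of_nonneg _ _ (by positivity), ← ENNReal.rpow_natCast,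
          ← ENNReal.rpow_mul]
        push_cast
        rw [mul_one_div_cancel (by positivity), ENNReal.rpow_one]
        rfl
      rw [this, ENNReal.toReal_mul]
      simp)

/-- The seminorm `‖·‖_{m,ℓ,R,S}` on `A_{p,ħ}`. -/
noncomputable def seminormA (m : ℕ) (l : Fin (2 ^ m)) (R S : Fin n → ℕ) :
    Seminorm ℂ (Aph p ħ) :=
  Seminorm.of
    (Quotient.lift (fun f : tildeA p ħ => seminormTilde p ħ m l R S f) (by
      intro f g hfg
      have h1 : toAph p ħ f = toAph p ħ g := Quotient.sound hfg
      have h2 := hph_congr p ħ ((toAph_eq_iff p ħ).1 h1) m l R S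
      change (hph p ħ (f : Smooth n) m l R S ^ _).toReal =
        (hph p ħ (g : Smooth n) m l R S ^ _).toReal
      rw [h2]))
    (by
      intro F G
      obtain ⟨f, rfl⟩ := toAph_surjective p ħ F
      obtain ⟨g, rfl⟩ := toAph_surjective p ħ G
      exact map_add_le_add (seminormTilde p ħ m l R S) f g)
    (by
      intro c F
      obtain ⟨f, rfl⟩ := toAph_surjective p ħ F
      exact map_smul_eq_mul (seminormTilde p ħ m l R S) c f)

/-- The family of all seminorms `‖·‖_{m,ℓ,R,S}` with `0 ≤ ℓ ≤ 2^m - 1`. -/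
noncomputable def seminormFamily :
    SeminormFamily ℂ (Aph p ħ) ((Σ m : ℕ, Fin (2 ^ m)) × (Fin n → ℕ) × (Fin n → ℕ)) :=
  fun i => seminormA p ħ i.1.1 i.1.2 i.2.1 i.2.2

/-- The locally convex topology of `A_{p,ħ}` determined by the seminorms. -/
noncomputable instance : TopologicalSpace (Aph p ħ) :=
  (seminormFamily p ħ).moduleFilterBasis.topology

theorem withSeminorms_seminormFamily : WithSeminorms (seminormFamily p ħ) := ⟨rfl⟩

theorem seminormA_toAph (m : ℕ) (l : Fin (2 ^ m)) (R S : Fin n → ℕ) (f : tildeA p ħ) :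
    seminormA p ħ m l R S (toAph p ħ f) = (normph p ħ m l R S (f : Smooth n)).toReal := rfl

/-- The operator on `A_{p,ħ}` induced by an operator on `C^∞(ℂⁿ)`. -/
noncomputable def liftEnd (T : Module.End ℂ (Smooth n))
    (hT : ∀ f ∈ tildeA p ħ, T f ∈ tildeA p ħ)
    (hT' : ∀ f, (∀ I J, jet p I J f = 0) → ∀ I J, jet p I J (T f) = 0) :
    Module.End ℂ (Aph p ħ) where
  toFun := Quotient.lift (fun f : tildeA p ħ => toAph p ħ ⟨T f, hT f f.2⟩) (by
    intro f g hfg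
    have h1 : toAph p ħ f = toAph p ħ g := Quotient.sound hfg
    rw [toAph_eq_iff] at h1 ⊢
    intro I J
    have := hT' ((f : Smooth n) - g) (fun I J => by
      have := h1 I J
      simp only [jet, map_sub] at this ⊢
      simpa [sub_eq_zero] using this) I J
    simp only [jet, map_sub] at this ⊢
    simpa [sub_eq_zero] using this)
  map_add' F G := by
    obtain ⟨f, rfl⟩ := toAph_surjective p ħ F
    obtain ⟨g, rfl⟩ := toAph_surjective p ħ G
    change toAph p ħ ⟨T ((f : Smooth n) + g), _⟩ = toAph p ħ ⟨T f, _⟩ + toAph p ħ ⟨T g, _⟩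
    rw [← map_add]
    congr 1
    exact Subtype.ext (map_add T _ _)
  map_smul' c F := by
    obtain ⟨f, rfl⟩ := toAph_surjective p ħ F
    change toAph p ħ ⟨T (c • (f : Smooth n)), _⟩ = c • toAph p ħ ⟨T f, _⟩
    rw [← map_smul]
    congr 1
    exact Subtype.ext (map_smul T _ _)

theorem mem_tildeA_iff {f : Smooth n} :
    f ∈ tildeA p ħ ↔ ∀ m l : ℕ, l < 2 ^ m → ∀ R S, hph p ħ f m l R S < ⊤ := by
  simp only [← normph_lt_top_iff]
  rfl

theorem mem_tildeA_of_shift [Fact (0 < ħ)] {f g : Smooth n} (i : Fin n)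
    (h : (∀ I J, jet p I J g = jet p (I + Pi.single i 1) J f) ∨
      (∀ I J, jet p I J g = jet p I (J + Pi.single i 1) f)) (hf : f ∈ tildeA p ħ) :
    g ∈ tildeA p ħ := by
  rw [mem_tildeA_iff] at *
  intro m l hl R S
  obtain ⟨c, hc, h1 | h1⟩ := hph_shift p ħ f g i m l h
  · exact (h1 R S).trans_lt (ENNReal.mul_lt_top hc (hf m l hl _ _))
  · exact (h1 R S).trans_lt (ENNReal.mul_lt_top hc (hf m l hl _ _))

/-- `∂/∂z^j` on `A_{p,ħ}`. -/
noncomputable def dzA [Fact (0 < ħ)] (j : Fin n) : Module.End ℂ (Aph p ħ) :=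
  liftEnd p ħ (dz j : Smooth n →ₗ[ℂ] Smooth n)
    (fun f hf => mem_tildeA_of_shift p ħ j (Or.inl fun I J => jet_dz p I J j f) hf)
    (fun f hf I J => (jet_dz p I J j f).trans (hf _ _))

/-- `∂/∂z̄^j` on `A_{p,ħ}`. -/
noncomputable def dzbarA [Fact (0 < ħ)] (j : Fin n) : Module.End ℂ (Aph p ħ) :=
  liftEnd p ħ (dzbar j : Smooth n →ₗ[ℂ] Smooth n)
    (fun f hf => mem_tildeA_of_shift p ħ j (Or.inr fun I J => jet_dzbar p I J j f) hf)
    (fun f hf I J => (jet_dzbar p I J j f).trans (hf _ _))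

variable {p ħ}

/-- The Wick star product on `A_{p,ħ}`,
`F ⋆_α G = ∑_N (2α)^{|N|}/N! (∂^{|N|}F/∂z^N) (∂^{|N|}G/∂z̄^N)`,
the (unconditional) sum of the series in the topology of `A_{p,ħ}`. -/
noncomputable def wick [Fact (0 < ħ)] (α : ℂ) (F G : Aph p ħ) : Aph p ħ :=
  ∑' N : Fin n → ℕ, ((2 * α) ^ mdeg N / (mfact N : ℂ)) •
    (multiPow (dzA p ħ) N F * multiPow (dzbarA p ħ) N G)

/-- The powers `a ⋆_α ⋯ ⋆_α a`. -/
noncomputable def wickPow [Fact (0 < ħ)] (α : ℂ) (a : Aph p ħ) : ℕ → Aph p ħ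
  | 0 => 1
  | k + 1 => wick α (wickPow α a k) a

/-- The terms of the series of `f ⋆_α g` for arbitrary smooth functions `f`, `g` on `ℂⁿ`. -/
noncomputable def wickTerm (α : ℂ) (f g : Smooth n) (N : Fin n → ℕ) : Smooth n :=
  ((2 * α) ^ mdeg N / (mfact N : ℂ)) • (dzPow N f * dzbarPow N g)

/-- The pointwise complex conjugate. -/
noncomputable def conjSmooth (f : Smooth n) : Smooth n :=
  ⟨fun z => starRingEnd ℂ ((f : (Fin n → ℂ) → ℂ) z),
    Complex.conjCLE.contDiff.comp (Smooth.contDiff f)⟩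

/-- The coordinate function `z^j`. -/
noncomputable def coord (j : Fin n) : Smooth n :=
  ⟨fun z => z j, by
    have : ContDiff ℝ ∞ fun z : Fin n → ℂ => z j :=
      (ContinuousLinearMap.proj j : (Fin n → ℂ) →L[ℝ] ℂ).contDiff
    exact this⟩

theorem dirDeriv_coord (v : Fin n → ℂ) (j : Fin n) :
    dirDeriv v (coord j) = algebraMap ℂ (Smooth n) (v j) := by
  ext z
  have := (ContinuousLinearMap.proj j : (Fin n → ℂ) →L[ℝ] ℂ).fderiv (x := z)
  exact DFunLike.congr_fun this v

theorem dz_coord (i j : Fin n) :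
    dz i (coord j) = algebraMap ℂ (Smooth n) (if i = j then 1 else 0) := by
  simp only [dz, Derivation.smul_apply, Derivation.sub_apply, dirDeriv_coord]
  rw [Algebra.smul_def, Algebra.smul_def, ← map_mul, ← map_sub, ← map_mul]
  congr 1
  by_cases h : i = j
  · subst h; simp; norm_num
  · simp [h, Ne.symm h]

theorem dzbar_coord (i j : Fin n) : dzbar i (coord j) = 0 := by
  simp only [dzbar, Derivation.smul_apply, Derivation.add_apply, dirDeriv_coord]
  rw [Algebra.smul_def, Algebra.smul_def, ← map_mul, ← map_add, ← map_mul, ← map_zero (algebraMap ℂ (Smooth n))]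
  congr 1
  by_cases h : i = j
  · subst h; simp
  · simp [Ne.symm h]

theorem coord_mem_tildeA (j : Fin n) : coord j ∈ tildeA p ħ := by
  rw [mem_tildeA_iff]
  intro m l _ R S
  refine hph_lt_top_of_geom p ħ _ (a := 1) (b := 1) (c := 1 + ‖p j‖ₑ) (by simp) (by simp)
    (by simp) (fun I J => ?_) m l R S
  simp only [one_pow, mul_one]
  rcases eq_zero_or_exists_add_single J with rfl | ⟨K, i, rfl⟩
  · rcases eq_zero_or_exists_add_single I with rfl | ⟨K, i, rfl⟩
    · simp only [jet, dzPow, dzbarPow, multiPow_zero]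
      exact le_add_self
    · rw [← jet_dz, dz_coord]
      refine (enorm_jet_const_le p _ _ _).trans (le_trans ?_ le_self_add)
      split_ifs <;> simp
  · rw [← jet_dzbar, dzbar_coord, jet_zero]; simp

variable (p ħ) in
/-- The coordinate function `z^j` as an element of `A_{p,ħ}`. -/
noncomputable def coordA (j : Fin n) : Aph p ħ := toAph p ħ ⟨coord j, coord_mem_tildeA j⟩

end space

/-! Local `m`-convexity and the holomorphic functional calculus. -/

/-- A locally convex space with a product is locally `m`-convex if its topology is defined by a set
of seminorms with `q(ab) ≤ q(a) q(b)`. -/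
def IsLocallyMConvex (A : Type) [AddCommGroup A] [Module ℂ A] [TopologicalSpace A]
    (mul : A → A → A) : Prop :=
  ∃ Q : Set (Seminorm ℂ A), WithSeminorms (fun q : Q => (q : Seminorm ℂ A)) ∧
    ∀ q ∈ Q, ∀ a b, q (mul a b) ≤ q a * q b

/-- The algebra of entire functions. -/
def Entire : Subalgebra ℂ (ℂ → ℂ) where
  carrier := {f | Differentiable ℂ f}
  mul_mem' {f g} hf hg := by
    have hf' : Differentiable ℂ f := hf
    have hg' : Differentiable ℂ g := hg
    exact hf'.mul hg'
  add_mem' {f g} hf hg := by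
    have hf' : Differentiable ℂ f := hf
    have hg' : Differentiable ℂ g := hg
    exact hf'.add hg'
  algebraMap_mem' c := by
    have : Differentiable ℂ (fun _ : ℂ => c) := differentiable_const c
    exact this

/-- The entire function `w ↦ w`. -/
def Entire.id : Entire := ⟨fun w => w, differentiable_id⟩

/-- The function `z ↦ f(z^j)` on `ℂⁿ`. -/
noncomputable def Entire.compCoord {n : ℕ} (f : Entire) (j : Fin n) : Smooth n :=
  ⟨fun z => (f : ℂ → ℂ) (z j), by
    have hf : Differentiable ℂ (f : ℂ → ℂ) := f.2
    have h1 : ContDiff ℝ ∞ (f : ℂ → ℂ) := (hf.contDiff (n := ∞)).restrict_scalars ℝ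
    exact h1.comp (ContinuousLinearMap.proj j : (Fin n → ℂ) →L[ℝ] ℂ).contDiff⟩

/-- An entire functional calculus for the element `a` of an algebra with product `mul`: a linear
map `Φ` (written `f ↦ f(a)`) from the entire functions with `1(a) = 1`, `id(a) = a` and
`(fg)(a) = mul (f(a)) (g(a))`. No continuity is required. A holomorphic functional calculus for
`a` (for functions holomorphic near the spectrum, say) restricts to an entire one. -/
structure IsEntireCalculus {A : Type} [Ring A] [Module ℂ A] (mul : A → A → A) (a : A)
    (Φ : Entire →ₗ[ℂ] A) : Prop where
  map_one : Φ 1 = 1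
  map_id : Φ Entire.id = a
  map_mul : ∀ f g, Φ (f * g) = mul (Φ f) (Φ g)

/-- Every element of the algebra has an entire functional calculus. -/
def HasEntireCalculus (A : Type) [Ring A] [Module ℂ A] (mul : A → A → A) : Prop :=
  ∀ a : A, ∃ Φ : Entire →ₗ[ℂ] A, IsEntireCalculus mul a Φ

end WickStar

namespace WickStar

/-! The entire function `∑ w^r / (r!)^{1/4}`. -/

/-- The sequence `(k!)^{1/4}`. -/
noncomputable def quarterFact (k : ℕ) : ℝ := (k ! : ℝ) ^ (1 / 4 : ℝ)

theorem quarterFact_pow_four (k : ℕ) : quarterFact k ^ 4 = k ! := by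
  rw [quarterFact, ← Real.rpow_natCast, ← Real.rpow_mul (by positivity)]
  norm_num

theorem quarterFact_pos (k : ℕ) : 0 < quarterFact k := by
  unfold quarterFact; positivity

theorem one_le_quarterFact (k : ℕ) : 1 ≤ quarterFact k :=
  Real.one_le_rpow (by exact_mod_cast k.factorial_pos) (by norm_num)

theorem quarterFact_add_le (k r : ℕ) :
    quarterFact (k + r) ≤ 2 ^ (k + r) * quarterFact k * quarterFact r := by
  have h1 := quarterFact_pos k
  have h2 := quarterFact_pos r
  rw [← pow_le_pow_iff_left₀ (quarterFact_pos _).le (by positivity) (four_ne_zero), mul_pow,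
    mul_pow, quarterFact_pow_four, quarterFact_pow_four, quarterFact_pow_four]
  have h3 : (k + r)! ≤ 2 ^ (k + r) * k ! * r ! := by
    rw [← Nat.add_choose_mul_factorial_mul_factorial]
    gcongr
    exact Nat.choose_le_two_pow _ _
  calc ((k + r)! : ℝ) ≤ 2 ^ (k + r) * k ! * r ! := by exact_mod_cast h3
    _ ≤ (2 ^ (k + r)) ^ 4 * k ! * r ! := by
      gcongr
      exact le_self_pow₀ (one_le_pow₀ one_le_two) (by norm_num)

theorem summable_pow_div_quarterFact (x : ℝ) :
    Summable fun r : ℕ => x ^ r / quarterFact r := by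
  rcases eq_or_ne x 0 with rfl | hx
  · refine summable_of_ne_finset_zero (s := {0}) fun r hr => ?_
    have : r ≠ 0 := by simpa using hr
    simp [this]
  refine summable_of_ratio_test_tendsto_lt_one (l := 0) one_pos ?_ ?_
  · exact Eventually.of_forall fun r => div_ne_zero (pow_ne_zero _ hx) (quarterFact_pos r).ne'
  · have e : ∀ r : ℕ, ‖x ^ (r + 1) / quarterFact (r + 1)‖ / ‖x ^ r / quarterFact r‖ =
        |x| * (((r + 1 : ℕ) : ℝ) ^ (1 / 4 : ℝ))⁻¹ := by
      intro r
      have h1 := quarterFact_pos r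
      have h2 : quarterFact (r + 1) = ((r + 1 : ℕ) : ℝ) ^ (1 / 4 : ℝ) * quarterFact r := by
        rw [quarterFact, quarterFact, ← Real.mul_rpow (by positivity) (by positivity),
          Nat.factorial_succ]
        push_cast; rfl
      have h3 : 0 < ((r + 1 : ℕ) : ℝ) ^ (1 / 4 : ℝ) := by positivity
      have h4 : 0 < |x| := abs_pos.2 hx
      rw [h2, norm_div, norm_div, norm_pow, norm_pow, Real.norm_eq_abs, Real.norm_eq_abs,
        Real.norm_eq_abs, abs_of_pos h1, abs_of_pos (mul_pos h3 h1), pow_succ]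
      field_simp
    simp only [e]
    have h5 : Tendsto (fun r : ℕ => (((r + 1 : ℕ) : ℝ) ^ (1 / 4 : ℝ))⁻¹) atTop (𝓝 0) :=
      ((tendsto_rpow_atTop (by norm_num : (0 : ℝ) < 1 / 4)).comp
        (tendsto_natCast_atTop_atTop.comp (tendsto_add_atTop_nat 1))).inv_tendsto_atTop
    simpa using h5.const_mul |x|

theorem not_factorial_le_geom (C D : ℝ) : ¬ ∀ k : ℕ, (k ! : ℝ) ≤ C * D ^ k := by
  intro h
  have h1 : Tendsto (fun k : ℕ => C * (D ^ k / k !)) atTop (𝓝 (C * 0)) :=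
    (FloorSemiring.tendsto_pow_div_factorial_atTop D).const_mul C
  have h2 : (1 : ℝ) ≤ C * 0 := by
    refine ge_of_tendsto' h1 fun k => ?_
    rw [← mul_div_assoc, one_le_div (by positivity)]
    exact h k
  norm_num at h2

theorem norm_pow_div_quarterFact (w : ℂ) (r : ℕ) :
    ‖w ^ r / (quarterFact r : ℂ)‖ = ‖w‖ ^ r / quarterFact r := by
  rw [norm_div, norm_pow, Complex.norm_real, Real.norm_of_nonneg (quarterFact_pos r).le]

/-- The partial sums of `∑ w^r / (r!)^{1/4}`. -/
noncomputable def quarterPoly (M : ℕ) (w : ℂ) : ℂ :=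
  ∑ r ∈ Finset.range M, w ^ r / (quarterFact r : ℂ)

theorem differentiable_quarterPoly (M : ℕ) : Differentiable ℂ (quarterPoly M) := by
  unfold quarterPoly
  fun_prop

/-- The function `w ↦ ∑ w^r / (r!)^{1/4}`. -/
noncomputable def quarterExp (w : ℂ) : ℂ := ∑' r : ℕ, w ^ r / (quarterFact r : ℂ)

theorem hasSum_quarterExp (w : ℂ) :
    HasSum (fun r : ℕ => w ^ r / (quarterFact r : ℂ)) (quarterExp w) := by
  refine (Summable.of_norm ?_).hasSum
  simp only [norm_pow_div_quarterFact]
  exact summable_pow_div_quarterFact _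

theorem tendsto_quarterPoly :
    TendstoLocallyUniformlyOn quarterPoly quarterExp atTop Set.univ := by
  rw [tendstoLocallyUniformlyOn_iff_forall_isCompact isOpen_univ]
  intro K _ hK
  obtain ⟨ρ, hρ⟩ := hK.isBounded.exists_norm_le
  refine tendstoUniformlyOn_tsum_nat (summable_pow_div_quarterFact ρ) fun r w hw => ?_
  rw [norm_pow_div_quarterFact]
  have := quarterFact_pos r
  gcongr
  exact hρ w hw

theorem differentiable_quarterExp : Differentiable ℂ quarterExp := by
  rw [← differentiableOn_univ]
  exact tendsto_quarterPoly.differentiableOn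
    (Eventually.of_forall fun M => (differentiable_quarterPoly M).differentiableOn) isOpen_univ

theorem differentiable_iterate_deriv {f : ℂ → ℂ} (hf : Differentiable ℂ f) (k : ℕ) :
    Differentiable ℂ (deriv^[k] f) := by
  have := (hf.contDiff (n := ∞)).iterate_deriv k
  exact this.differentiable (by simp)

theorem tendsto_iterate_deriv_quarterPoly (k : ℕ) :
    TendstoLocallyUniformlyOn (fun M => deriv^[k] (quarterPoly M)) (deriv^[k] quarterExp) atTop
      Set.univ := by
  induction k with
  | zero => exact tendsto_quarterPoly
  | succ k ih =>
    have := ih.deriv (Eventually.of_forall fun M =>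
      (differentiable_iterate_deriv (differentiable_quarterPoly M) k).differentiableOn) isOpen_univ
    simp only [Function.iterate_succ_apply']
    exact this

theorem iterate_deriv_quarterExp_zero (k : ℕ) :
    deriv^[k] quarterExp 0 = ((quarterFact k ^ 3 : ℝ) : ℂ) := by
  have h1 : AnalyticAt ℂ quarterExp 0 := differentiable_quarterExp.analyticAt 0
  have h2 : HasFPowerSeriesAt quarterExp
      (FormalMultilinearSeries.ofScalars ℂ fun r => ((quarterFact r : ℂ))⁻¹) 0 := by
    rw [hasFPowerSeriesAt_iff]
    refine Eventually.of_forall fun w => ?_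
    simpa [FormalMultilinearSeries.coeff_ofScalars, div_eq_mul_inv] using hasSum_quarterExp w
  have h3 := congrArg (fun q => FormalMultilinearSeries.coeff q k)
    (h1.hasFPowerSeriesAt.eq_formalMultilinearSeries h2)
  simp only [FormalMultilinearSeries.coeff_ofScalars, iteratedDeriv_eq_iterate] at h3
  have h4 : (quarterFact k : ℂ) ≠ 0 := by exact_mod_cast (quarterFact_pos k).ne'
  have h5 : (k ! : ℂ) = (quarterFact k : ℂ) ^ 4 := by
    exact_mod_cast (quarterFact_pow_four k).symm
  rw [div_eq_iff (by exact_mod_cast k.factorial_ne_zero), h5] at h3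
  rw [h3]
  push_cast
  field_simp

/-- The Taylor coefficients of `∑ w^r / (r!)^{1/4}` at any point are large. -/
theorem not_iterate_deriv_quarterExp_le (c : ℂ) (s B : ℝ) :
    ¬ ∀ k : ℕ, ‖deriv^[k] quarterExp c‖ ≤ s * B ^ k * quarterFact k := by
  intro h
  wlog hB : 0 ≤ B generalizing B
  · refine this |B| (fun k => (h k).trans ?_) (abs_nonneg B)
    have hs : 0 ≤ s := by
      have := (norm_nonneg _).trans (h 0)
      simpa [quarterFact] using this
    have := quarterFact_pos k
    have : B ^ k ≤ |B| ^ k := (le_abs_self _).trans (abs_pow B k).le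
    gcongr
  have hs : 0 ≤ s := by
    have := (norm_nonneg _).trans (h 0)
    simpa [quarterFact] using this
  set T := ∑' r : ℕ, (2 * B * ‖c‖) ^ r / quarterFact r with hT
  have key : ∀ k : ℕ, quarterFact k ^ 3 ≤ s * (2 * B) ^ k * quarterFact k * T := by
    intro k
    have h1 := Complex.hasSum_taylorSeries_of_entire
      (differentiable_iterate_deriv differentiable_quarterExp k) c 0
    have h2 := h1.tsum_eq
    rw [iterate_deriv_quarterExp_zero] at h2
    have h3 := (summable_pow_div_quarterFact (2 * B * ‖c‖)).hasSum.mul_left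
      (s * (2 * B) ^ k * quarterFact k)
    have h4 := tsum_of_norm_bounded h3 (f := fun r : ℕ => ((r ! : ℂ))⁻¹ • (0 - c) ^ r •
      iteratedDeriv r (deriv^[k] quarterExp) c) (fun r => ?_)
    · rw [h2, Complex.norm_real, Real.norm_of_nonneg (by have := quarterFact_pos k; positivity)]
        at h4
      exact h4
    · have hk := quarterFact_pos k
      have hr := quarterFact_pos r
      have hr1 := one_le_quarterFact r
      rw [iteratedDeriv_eq_iterate, ← Function.iterate_add_apply, zero_sub, smul_eq_mul,
        smul_eq_mul, norm_mul, norm_mul, norm_pow, norm_neg, norm_inv, Complex.norm_natCast]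
      calc (r ! : ℝ)⁻¹ * (‖c‖ ^ r * ‖deriv^[r + k] quarterExp c‖)
          ≤ (r ! : ℝ)⁻¹ * (‖c‖ ^ r * (s * B ^ (k + r) *
              (2 ^ (k + r) * quarterFact k * quarterFact r))) := by
            gcongr
            rw [add_comm r k]
            refine (h _).trans ?_
            gcongr
            exact quarterFact_add_le k r
        _ = s * (2 * B) ^ k * quarterFact k *
              ((2 * B * ‖c‖) ^ r * (quarterFact r / quarterFact r ^ 4)) := by
            rw [quarterFact_pow_four]
            ring
        _ ≤ s * (2 * B) ^ k * quarterFact k * ((2 * B * ‖c‖) ^ r * (1 / quarterFact r)) := by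
            have h6 : quarterFact r ^ 2 ≤ quarterFact r ^ 4 :=
              pow_le_pow_right₀ hr1 (by norm_num)
            have h7 : quarterFact r / quarterFact r ^ 4 ≤ 1 / quarterFact r := by
              rw [div_le_div_iff₀ (by positivity) hr]
              linarith
            gcongr
        _ = _ := by ring
  refine not_factorial_le_geom ((s * T) ^ 2) ((2 * B) ^ 2) fun k => ?_
  have hk := quarterFact_pos k
  have h5 : quarterFact k ^ 2 ≤ s * T * (2 * B) ^ k := by
    have := key k
    rw [← mul_le_mul_iff_left₀ hk]
    linarith
  calc (k ! : ℝ) = (quarterFact k ^ 2) ^ 2 := by rw [← quarterFact_pow_four]; ring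
    _ ≤ (s * T * (2 * B) ^ k) ^ 2 := by gcongr
    _ = _ := by rw [mul_pow, ← pow_mul, ← pow_mul, mul_comm k 2]

/-! Derivatives of `z ↦ f(z^j)` for entire `f`. -/

/-- The derivative of an entire function. -/
noncomputable def Entire.deriv (f : Entire) : Entire :=
  ⟨_root_.deriv (f : ℂ → ℂ), differentiable_iterate_deriv f.2 1⟩

theorem Entire.coe_iterate_deriv (f : Entire) (k : ℕ) :
    ((Entire.deriv^[k] f : Entire) : ℂ → ℂ) = _root_.deriv^[k] (f : ℂ → ℂ) := by
  induction k with
  | zero => rfl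
  | succ k ih =>
    rw [Function.iterate_succ_apply', Function.iterate_succ_apply', ← ih]
    rfl

section smooth
variable {n : ℕ}

theorem dirDeriv_compCoord (v : Fin n → ℂ) (f : Entire) (j : Fin n) :
    dirDeriv v (Entire.compCoord f j) = v j • Entire.compCoord (Entire.deriv f) j := by
  ext z
  have hf : HasDerivAt (f : ℂ → ℂ) (_root_.deriv (f : ℂ → ℂ) (z j)) (z j) :=
    (show Differentiable ℂ (f : ℂ → ℂ) from f.2).differentiableAt.hasDerivAt
  have h := (hf.hasFDerivAt.restrictScalars ℝ).comp z
    (ContinuousLinearMap.proj j : (Fin n → ℂ) →L[ℝ] ℂ).hasFDerivAt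
  have := DFunLike.congr_fun h.fderiv v
  exact this

theorem dz_compCoord (i j : Fin n) (f : Entire) :
    dz i (Entire.compCoord f j) = if i = j then Entire.compCoord (Entire.deriv f) j else 0 := by
  simp only [dz, Derivation.smul_apply, Derivation.sub_apply, dirDeriv_compCoord, smul_smul]
  rcases eq_or_ne i j with rfl | h
  · rw [← sub_smul, smul_smul]
    norm_num
  · simp [h, h.symm]

theorem dirDeriv_conjSmooth (v : Fin n → ℂ) (f : Smooth n) :
    dirDeriv v (conjSmooth f) = conjSmooth (dirDeriv v f) := by
  ext z
  have h := (Complex.conjCLE.toContinuousLinearMap.hasFDerivAt (x := (f : (Fin n → ℂ) → ℂ) z)).comp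
    z (Smooth.diff f z).hasFDerivAt
  exact DFunLike.congr_fun h.fderiv v

theorem dzbar_conjSmooth (i : Fin n) (f : Smooth n) :
    dzbar i (conjSmooth f) = conjSmooth (dz i f) := by
  simp only [dz, dzbar, Derivation.smul_apply, Derivation.sub_apply, Derivation.add_apply,
    dirDeriv_conjSmooth]
  ext z
  simp [conjSmooth, map_ofNat (starRingEnd ℂ) 2]
  ring

theorem dzbarPow_conjSmooth (R : Fin n → ℕ) (f : Smooth n) :
    dzbarPow R (conjSmooth f) = conjSmooth (dzPow R f) := by
  induction R using multi_induction generalizing f with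
  | h0 => simp [dzPow, dzbarPow, multiPow_zero]
  | hs R i ih => rw [dzbarPow_add_single, dzPow_add_single, dzbar_conjSmooth, ih]

theorem single_succ (j : Fin n) (k : ℕ) :
    (Pi.single j (k + 1) : Fin n → ℕ) = Pi.single j k + Pi.single j 1 :=
  Pi.single_add (f := fun _ : Fin n => ℕ) j k 1

theorem dzPow_single_compCoord (j : Fin n) (k : ℕ) (f : Entire) :
    dzPow (Pi.single j k) (Entire.compCoord f j) = Entire.compCoord (Entire.deriv^[k] f) j := by
  induction k generalizing f with
  | zero => simp [dzPow, multiPow_zero]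
  | succ k ih => rw [single_succ, dzPow_add_single, dz_compCoord, if_pos rfl, ih]; rfl

theorem dzPow_compCoord_of_notMem (j : Fin n) {N : Fin n → ℕ}
    (hN : N ∉ Set.range fun k : ℕ => (Pi.single j k : Fin n → ℕ)) (f : Entire) :
    dzPow N (Entire.compCoord f j) = 0 := by
  obtain ⟨i, hij, hi⟩ : ∃ i, i ≠ j ∧ N i ≠ 0 := by
    by_contra! hc
    refine hN ⟨N j, ?_⟩
    ext i
    rcases eq_or_ne i j with rfl | h
    · simp
    · simp [h, hc i h]
  have hle : Pi.single i 1 ≤ N := by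
    intro l
    rcases eq_or_ne l i with rfl | h
    · simp; omega
    · simp [h]
  rw [← tsub_add_cancel_of_le hle, dzPow_add_single, dz_compCoord, if_neg hij, map_zero]

/-! Holomorphic jets in one coordinate direction. -/

variable (p : Fin n → ℂ)

theorem jet_single_succ (j : Fin n) (k : ℕ) (f : Smooth n) :
    jet p (Pi.single j (k + 1)) 0 f = jet p (Pi.single j k) 0 (dz j f) := by
  rw [single_succ, jet_dz]

theorem jet_zero_zero (f : Smooth n) : jet p 0 0 f = (f : (Fin n → ℂ) → ℂ) p := by
  simp [jet, dzPow, dzbarPow, multiPow_zero]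

theorem jet_single_compCoord (j : Fin n) (k : ℕ) (f : Entire) :
    jet p (Pi.single j k) 0 (Entire.compCoord f j) = deriv^[k] (f : ℂ → ℂ) (p j) := by
  rw [jet, dzbarPow, multiPow_zero, Module.End.one_apply, dzPow_single_compCoord,
    ← Entire.coe_iterate_deriv]
  rfl

theorem jet_single_succ_mul {j : Fin n} {x : Smooth n} (hx : dz j x = 1)
    (hx0 : (x : (Fin n → ℂ) → ℂ) p = 0) (k : ℕ) (f : Smooth n) :
    jet p (Pi.single j (k + 1)) 0 (f * x) = (k + 1) * jet p (Pi.single j k) 0 f := by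
  induction k generalizing f with
  | zero =>
    rw [jet_single_succ, Derivation.leibniz, hx, smul_eq_mul, smul_eq_mul, mul_one, jet_add,
      Pi.single_zero, jet_zero_zero, jet_zero_zero]
    simp [hx0]
  | succ k ih =>
    rw [jet_single_succ, Derivation.leibniz, hx, smul_eq_mul, smul_eq_mul, mul_one, jet_add,
      mul_comm, ih, ← jet_single_succ]
    push_cast
    ring

theorem mfact_single (j : Fin n) (k : ℕ) : mfact (Pi.single j k : Fin n → ℕ) = k ! := by
  rw [mfact, Finset.prod_eq_single j]
  · simp
  · intro i _ hi; simp [hi]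
  · simp

theorem mdeg_single (j : Fin n) (k : ℕ) : mdeg (Pi.single j k : Fin n → ℕ) = k := by
  simp [mdeg]

theorem summable_wickTerm_iff (j : Fin n) (f : Entire) (β : ℂ) :
    Summable (fun N : Fin n → ℕ =>
      (wickTerm β (Entire.compCoord f j) (conjSmooth (Entire.compCoord f j)) N : (Fin n → ℂ) → ℂ) 0) ↔
    Summable fun k : ℕ => (2 * β) ^ k / (k ! : ℂ) *
      (deriv^[k] (f : ℂ → ℂ) 0 * starRingEnd ℂ (deriv^[k] (f : ℂ → ℂ) 0)) := by
  rw [← (Pi.single_injective (M := fun _ : Fin n => ℕ) j).summable_iff]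
  · refine summable_congr fun k => ?_
    simp only [Function.comp_apply, wickTerm, mdeg_single, mfact_single, dzbarPow_conjSmooth,
      dzPow_single_compCoord, ← Entire.coe_iterate_deriv]
    rfl
  · intro N hN
    rw [wickTerm, dzPow_compCoord_of_notMem j hN, zero_mul, smul_zero]
    rfl

end smooth

theorem summable_quarterExp_iff (β : ℂ) :
    Summable (fun k : ℕ => (2 * β) ^ k / (k ! : ℂ) *
      (deriv^[k] quarterExp 0 * starRingEnd ℂ (deriv^[k] quarterExp 0))) ↔ β = 0 := by
  have e : ∀ k : ℕ, (2 * β) ^ k / (k ! : ℂ) *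
      (deriv^[k] quarterExp 0 * starRingEnd ℂ (deriv^[k] quarterExp 0)) =
      (2 * β) ^ k * (quarterFact k : ℂ) ^ 2 := by
    intro k
    have h4 : (quarterFact k : ℂ) ≠ 0 := by exact_mod_cast (quarterFact_pos k).ne'
    have h5 : (k ! : ℂ) = (quarterFact k : ℂ) ^ 4 := by
      exact_mod_cast (quarterFact_pow_four k).symm
    rw [iterate_deriv_quarterExp_zero, Complex.conj_ofReal, h5]
    push_cast
    field_simp
  simp only [e]
  constructor
  · intro h
    by_contra hβ
    obtain ⟨C, hC⟩ := h.tendsto_atTop_zero.norm.bddAbove_range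
    have hb : 0 < ‖2 * β‖ := by simpa using hβ
    refine not_factorial_le_geom (C ^ 2) ((‖2 * β‖⁻¹) ^ 2) fun k => ?_
    have h1 : ‖2 * β‖ ^ k * quarterFact k ^ 2 ≤ C := by
      have := hC ⟨k, rfl⟩
      simpa only [norm_mul, norm_pow, Complex.norm_real,
        Real.norm_of_nonneg (quarterFact_pos k).le] using this
    have h2 : quarterFact k ^ 2 ≤ C * ‖2 * β‖⁻¹ ^ k := by
      rw [inv_pow, ← div_eq_mul_inv, le_div_iff₀ (by positivity)]
      linarith
    calc (k ! : ℝ) = (quarterFact k ^ 2) ^ 2 := by rw [← quarterFact_pow_four]; ring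
      _ ≤ (C * ‖2 * β‖⁻¹ ^ k) ^ 2 := by gcongr
      _ = _ := by rw [mul_pow, ← pow_mul, ← pow_mul, mul_comm k 2]
  · rintro rfl
    refine summable_of_ne_finset_zero (s := {0}) fun r hr => ?_
    have : r ≠ 0 := by simpa using hr
    simp [this]

section space
variable {n : ℕ} (p : Fin n → ℂ) (ħ : ℝ)

/-- The seminorm `‖·‖_{1,1,0,0}` controls the holomorphic jets. -/
theorem jet_pow_four_le_hph (N : Fin n → ℕ) (f : Smooth n) :
    (mfact N : ℝ≥0∞)⁻¹ * (ENNReal.ofReal (2 * ħ) ^ mdeg N * ‖jet p N 0 f‖ₑ ^ 2) ^ 2 ≤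
      hph p ħ f 1 1 0 0 := by
  have e : hph p ħ f 1 1 0 0 = hStep (fun I J => hph p ħ f 0 0 J I) 0 0 := by
    rw [hph]; simp
  rw [e, hStep]
  refine le_trans ?_ (ENNReal.le_tsum N)
  gcongr
  have h1 : mchoose N N = 1 := by simp [mchoose]
  have h2 : mchoose (0 : Fin n → ℕ) 0 = 1 := by simp [mchoose]
  calc ENNReal.ofReal (2 * ħ) ^ mdeg N * ‖jet p N 0 f‖ₑ ^ 2
      ≤ (mchoose (0 : Fin n → ℕ) 0 : ℝ≥0∞) * (mchoose (N + 0) N : ℝ≥0∞) *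
          hph p ħ f 0 0 N 0 := by
        rw [add_zero, h1, h2, Nat.cast_one, one_mul, one_mul]
        refine le_trans (le_of_eq ?_) (mul_jet_le p ħ f N 0)
        simp [mdeg]
    _ ≤ ∑ J ∈ Iic (N + 0), (mchoose (0 : Fin n → ℕ) 0 : ℝ≥0∞) *
          (mchoose (N + 0) J : ℝ≥0∞) * hph p ħ f 0 0 J 0 :=
        Finset.single_le_sum (f := fun J => (mchoose (0 : Fin n → ℕ) 0 : ℝ≥0∞) *
          (mchoose (N + 0) J : ℝ≥0∞) * hph p ħ f 0 0 J 0) (fun _ _ => zero_le)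
          (mem_Iic.2 (by simp))
    _ ≤ _ := Finset.single_le_sum (f := fun I => ∑ J ∈ Iic (N + 0),
          (mchoose (0 : Fin n → ℕ) I : ℝ≥0∞) * (mchoose (N + 0) J : ℝ≥0∞) * hph p ħ f 0 0 J I)
          (fun _ _ => zero_le) (mem_Iic.2 le_rfl)

/-- The jet coefficients as linear functionals on `A_{p,ħ}`. -/
noncomputable def jetA (I J : Fin n → ℕ) : Aph p ħ →ₗ[ℂ] ℂ where
  toFun := Quotient.lift (fun f : tildeA p ħ => jet p I J (f : Smooth n)) (by
    intro f g hfg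
    have h1 : toAph p ħ f = toAph p ħ g := Quotient.sound hfg
    exact (toAph_eq_iff p ħ).1 h1 I J)
  map_add' F G := by
    obtain ⟨f, rfl⟩ := toAph_surjective p ħ F
    obtain ⟨g, rfl⟩ := toAph_surjective p ħ G
    exact jet_add p I J f g
  map_smul' c F := by
    obtain ⟨f, rfl⟩ := toAph_surjective p ħ F
    exact jet_smul p I J c f

theorem jetA_toAph (I J : Fin n → ℕ) (f : tildeA p ħ) :
    jetA p ħ I J (toAph p ħ f) = jet p I J (f : Smooth n) := rfl

/-- The seminorm `‖·‖_{1,1,0,0}`. -/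
noncomputable def holSeminorm : Seminorm ℂ (Aph p ħ) :=
  seminormA p ħ 1 1 0 0

theorem continuous_holSeminorm : Continuous (holSeminorm p ħ) :=
  (withSeminorms_seminormFamily p ħ).continuous_seminorm (⟨1, 1⟩, 0, 0)

theorem jetA_pow_four_le [hħ : Fact (0 < ħ)] (j : Fin n) (k : ℕ) (F : Aph p ħ) :
    ((2 * ħ) ^ k * ‖jetA p ħ (Pi.single j k) 0 F‖ ^ 2) ^ 2 ≤ k ! * holSeminorm p ħ F ^ 4 := by
  obtain ⟨f, rfl⟩ := toAph_surjective p ħ F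
  have hpos : 0 < 2 * ħ := mul_pos two_pos hħ.out
  have h1 := jet_pow_four_le_hph p ħ (Pi.single j k) (f : Smooth n)
  rw [mfact_single, mdeg_single] at h1
  have hfin : hph p ħ (f : Smooth n) 1 1 0 0 < ⊤ :=
    (mem_tildeA_iff p ħ).1 f.2 1 1 (by norm_num) 0 0
  have h2 := ENNReal.toReal_mono hfin.ne h1
  have h3 : holSeminorm p ħ (toAph p ħ f) ^ 4 = (hph p ħ (f : Smooth n) 1 1 0 0).toReal := by
    change ((hph p ħ (f : Smooth n) 1 1 0 0 ^ (1 / (2 : ℝ) ^ (1 + 1))).toReal) ^ 4 = _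
    rw [← ENNReal.toReal_pow, ← ENNReal.rpow_natCast, ← ENNReal.rpow_mul]
    norm_num
  simp only [ENNReal.toReal_mul, ENNReal.toReal_pow, ENNReal.toReal_inv, ENNReal.toReal_natCast,
    ENNReal.toReal_ofReal hpos.le, toReal_enorm] at h2
  rw [h3, jetA_toAph]
  rw [inv_mul_le_iff₀ (by positivity)] at h2
  exact h2

theorem exists_norm_jetA_le [hħ : Fact (0 < ħ)] (j : Fin n) : ∃ B : ℝ, 0 < B ∧ ∀ k (F : Aph p ħ),
    ‖jetA p ħ (Pi.single j k) 0 F‖ ≤ holSeminorm p ħ F * B ^ k * quarterFact k := by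
  have hpos : 0 < 2 * ħ := mul_pos two_pos hħ.out
  refine ⟨(Real.sqrt (2 * ħ))⁻¹, by positivity, fun k F => ?_⟩
  have hq := quarterFact_pos k
  have hs : 0 ≤ holSeminorm p ħ F := apply_nonneg _ _
  rw [← pow_le_pow_iff_left₀ (norm_nonneg _) (by positivity) four_ne_zero, mul_pow, mul_pow,
    quarterFact_pow_four, ← pow_mul, mul_comm k 4, pow_mul, inv_pow,
    show Real.sqrt (2 * ħ) ^ 4 = (2 * ħ) ^ 2 by
      rw [show 4 = 2 * 2 from rfl, pow_mul, Real.sq_sqrt hpos.le], inv_pow, mul_right_comm,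
    ← div_eq_mul_inv, le_div_iff₀ (by positivity)]
  have := jetA_pow_four_le p ħ j k F
  calc _ = ((2 * ħ) ^ k * ‖jetA p ħ (Pi.single j k) 0 F‖ ^ 2) ^ 2 := by
        rw [mul_pow ((2 * ħ) ^ k), ← pow_mul, ← pow_mul, ← pow_mul, mul_comm k 2, mul_comm]
    _ ≤ _ := by linarith

/-- No element of `A_{p,ħ}` has the holomorphic jet of `∑ (z^j)^r / (r!)^{1/4}`. -/
theorem not_jetA_eq_quarterExp [Fact (0 < ħ)] (j : Fin n) (F : Aph p ħ) :
    ¬ ∀ k, jetA p ħ (Pi.single j k) 0 F = deriv^[k] quarterExp (p j) := by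
  intro h
  obtain ⟨B, -, hB⟩ := exists_norm_jetA_le p ħ j
  refine not_iterate_deriv_quarterExp_le (p j) (holSeminorm p ħ F) B fun k => ?_
  rw [← h k]
  exact hB k F

theorem tendsto_jetA [Fact (0 < ħ)] (j : Fin n) (k : ℕ) {u : ℕ → Aph p ħ} {F : Aph p ħ}
    (hu : Tendsto u atTop (𝓝 F)) :
    Tendsto (fun M => jetA p ħ (Pi.single j k) 0 (u M)) atTop
      (𝓝 (jetA p ħ (Pi.single j k) 0 F)) := by
  obtain ⟨B, hB0, hB⟩ := exists_norm_jetA_le p ħ j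
  have h0 := ((withSeminorms_seminormFamily p ħ).tendsto_nhds u F).1 hu (⟨1, 1⟩, 0, 0)
  have hq := quarterFact_pos k
  rw [Metric.tendsto_atTop']
  intro ε hε
  obtain ⟨M, hM⟩ := eventually_atTop.1 (h0 (ε / (B ^ k * quarterFact k)) (by positivity))
  refine ⟨M, fun m hm => ?_⟩
  have h1 : holSeminorm p ħ (u m - F) < ε / (B ^ k * quarterFact k) := hM m hm.le
  rw [dist_eq_norm, ← map_sub]
  refine (hB k _).trans_lt ?_
  rw [lt_div_iff₀ (by positivity)] at h1
  linarith

variable {p ħ}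

variable (p) in
/-- The function `z^j - p^j`. -/
noncomputable def centered (j : Fin n) : Smooth n := coord j - algebraMap ℂ (Smooth n) (p j)

variable (p ħ) in
/-- The class of `z^j - p^j`. -/
noncomputable def centeredA (j : Fin n) : Aph p ħ :=
  coordA p ħ j - algebraMap ℂ (Aph p ħ) (p j)

theorem centeredA_eq (j : Fin n) : ∃ h : centered p j ∈ tildeA p ħ,
    centeredA p ħ j = toAph p ħ ⟨centered p j, h⟩ := by
  refine ⟨sub_mem (coord_mem_tildeA j) (algebraMap_mem _ _), ?_⟩
  rw [centeredA, coordA, ← AlgHom.commutes (toAph p ħ), ← map_sub]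
  rfl

theorem dz_centered (j : Fin n) : dz j (centered p j) = 1 := by
  rw [centered, map_sub, dz_coord, Derivation.map_algebraMap]
  simp

theorem centered_apply_self (j : Fin n) : (centered p j : (Fin n → ℂ) → ℂ) p = 0 :=
  sub_self (p j)

theorem jetA_mul_centeredA (j : Fin n) (k : ℕ) (X : Aph p ħ) :
    jetA p ħ (Pi.single j (k + 1)) 0 (X * centeredA p ħ j) =
      (k + 1) * jetA p ħ (Pi.single j k) 0 X := by
  obtain ⟨h, e⟩ := centeredA_eq (p := p) (ħ := ħ) j
  obtain ⟨f, rfl⟩ := toAph_surjective p ħ X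
  rw [e, ← map_mul]
  exact jet_single_succ_mul p (dz_centered j) (centered_apply_self j) k f

theorem jetA_zero_mul_centeredA (j : Fin n) (X : Aph p ħ) :
    jetA p ħ 0 0 (X * centeredA p ħ j) = 0 := by
  obtain ⟨h, e⟩ := centeredA_eq (p := p) (ħ := ħ) j
  obtain ⟨f, rfl⟩ := toAph_surjective p ħ X
  rw [e, ← map_mul, jetA_toAph, jet_zero_zero]
  exact mul_eq_zero_of_right _ (centered_apply_self j)

theorem jetA_one : jetA p ħ 0 0 1 = 1 := by
  rw [← map_one (toAph p ħ), jetA_toAph, jet_zero_zero]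
  rfl

theorem jetA_single_succ_one (j : Fin n) (k : ℕ) : jetA p ħ (Pi.single j (k + 1)) 0 1 = 0 := by
  rw [← map_one (toAph p ħ), jetA_toAph, jet_single_succ]
  have : dz j ((1 : tildeA p ħ) : Smooth n) = 0 := Derivation.map_one_eq_zero _
  rw [this, jet_zero]

theorem jetA_centeredA_pow (j : Fin n) (r : ℕ) :
    jetA p ħ (Pi.single j r) 0 (centeredA p ħ j ^ r) = r ! := by
  induction r with
  | zero => rw [pow_zero, Pi.single_zero, jetA_one]; simp
  | succ r ih => rw [pow_succ, jetA_mul_centeredA, ih, Nat.factorial_succ]; push_cast; rfl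

/-- The jet of a polynomial in `z^j`, as an element of `A_{p,ħ}`. -/
theorem jetA_sum_coordA_pow (j : Fin n) (k M : ℕ) :
    jetA p ħ (Pi.single j k) 0 (∑ r ∈ Finset.range M, (quarterFact r : ℂ)⁻¹ • coordA p ħ j ^ r) =
      deriv^[k] (quarterPoly M) (p j) := by
  have h := jet_single_compCoord p j k ⟨quarterPoly M, differentiable_quarterPoly M⟩
  rw [← h]
  simp only [coordA, ← map_pow, ← map_smul, ← map_sum]
  rw [jetA_toAph]
  congr 1
  ext z
  simp [Entire.compCoord, quarterPoly, coord, div_eq_mul_inv, mul_comm]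

variable (p ħ) [Fact (0 < ħ)]

theorem dzbarA_toAph (i : Fin n) (f : tildeA p ħ) (h : dzbar i (f : Smooth n) = 0) :
    dzbarA p ħ i (toAph p ħ f) = 0 := by
  rw [← map_zero (toAph p ħ)]
  change toAph p ħ ⟨dzbar i (f : Smooth n), _⟩ = _
  congr 1
  exact Subtype.ext h

theorem commute_dzbarA (i j : Fin n) : Commute (dzbarA p ħ i) (dzbarA p ħ j) := by
  ext1 F
  obtain ⟨f, rfl⟩ := toAph_surjective p ħ F
  change toAph p ħ ⟨dzbar i (dzbar j (f : Smooth n)), _⟩ =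
    toAph p ħ ⟨dzbar j (dzbar i (f : Smooth n)), _⟩
  congr 1
  exact Subtype.ext (dzbar_dzbar i j _)

variable {p ħ}

/-- On a holomorphic right factor the Wick product is the pointwise product. -/
theorem wick_eq_mul (α : ℂ) (X a : Aph p ħ) (ha : ∀ i, dzbarA p ħ i a = 0) :
    wick α X a = X * a := by
  rw [wick, tsum_eq_single 0]
  · simp [mdeg, mfact, multiPow_zero]
  · intro N hN
    rcases eq_zero_or_exists_add_single N with rfl | ⟨K, i, rfl⟩
    · exact absurd rfl hN
    · rw [multiPow_add_single (commute_dzbarA p ħ), Module.End.mul_apply, ha, map_zero, mul_zero,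
        smul_zero]

theorem dzbarA_coordA (i j : Fin n) : dzbarA p ħ i (coordA p ħ j) = 0 :=
  dzbarA_toAph p ħ i _ (dzbar_coord i j)

theorem wickPow_coordA (α : ℂ) (j : Fin n) (r : ℕ) :
    wickPow α (coordA p ħ j) r = coordA p ħ j ^ r := by
  induction r with
  | zero => rfl
  | succ r ih => rw [wickPow, ih, wick_eq_mul α _ _ fun i => dzbarA_coordA i j, pow_succ]

theorem dzbarA_centeredA (i j : Fin n) : dzbarA p ħ i (centeredA p ħ j) = 0 := by
  obtain ⟨h, e⟩ := centeredA_eq (p := p) (ħ := ħ) j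
  rw [e]
  refine dzbarA_toAph p ħ i _ ?_
  change dzbar i (centered p j) = 0
  rw [centered, map_sub, dzbar_coord, Derivation.map_algebraMap, sub_zero]

theorem not_tendsto_sum_wickPow (j : Fin n) (α : ℂ) : ¬ ∃ F : Aph p ħ,
    Tendsto (fun M : ℕ => ∑ r ∈ Finset.range M,
      (quarterFact r : ℂ)⁻¹ • wickPow α (coordA p ħ j) r) atTop (𝓝 F) := by
  rintro ⟨F, hF⟩
  refine not_jetA_eq_quarterExp p ħ j F fun k => ?_
  have h1 := tendsto_jetA p ħ j k hF
  simp only [wickPow_coordA, jetA_sum_coordA_pow] at h1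
  exact tendsto_nhds_unique h1
    ((tendsto_iterate_deriv_quarterPoly k).tendsto_at (Set.mem_univ _))

theorem compCoord_quarterExp_notMem (j : Fin n) :
    Entire.compCoord ⟨quarterExp, differentiable_quarterExp⟩ j ∉ tildeA p ħ := fun h =>
  not_jetA_eq_quarterExp p ħ j (toAph p ħ ⟨_, h⟩) fun k =>
    jet_single_compCoord p j k ⟨quarterExp, differentiable_quarterExp⟩

/-- An entire functional calculus for `z^j` is compatible with the holomorphic jets. -/
theorem IsEntireCalculus.jetA_eq {α : ℂ} {j : Fin n} {Φ : Entire →ₗ[ℂ] Aph p ħ}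
    (hΦ : IsEntireCalculus (wick α) (coordA p ħ j) Φ) (k : ℕ) (f : Entire) :
    jetA p ħ (Pi.single j k) 0 (Φ f) = deriv^[k] (f : ℂ → ℂ) (p j) := by
  have hdec : ∀ f : Entire, ∃ g : Entire,
      f = (f : ℂ → ℂ) (p j) • 1 + g * (Entire.id - p j • 1) := by
    intro f
    have hf : Differentiable ℂ (f : ℂ → ℂ) := f.2
    refine ⟨⟨dslope (f : ℂ → ℂ) (p j), ?_⟩, ?_⟩
    · change Differentiable ℂ _
      rw [← differentiableOn_univ, Complex.differentiableOn_dslope univ_mem]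
      exact hf.differentiableOn
    · ext w
      have := sub_smul_dslope (f : ℂ → ℂ) (p j) w
      simp only [smul_eq_mul] at this
      change (f : ℂ → ℂ) w =
        (f : ℂ → ℂ) (p j) * 1 + dslope (f : ℂ → ℂ) (p j) w * (w - p j * 1)
      linear_combination -this
  have hΦdec : ∀ (c : ℂ) (g : Entire), Φ (c • 1 + g * (Entire.id - p j • 1)) =
      c • 1 + Φ g * centeredA p ħ j := by
    intro c g
    have h1 : Φ (Entire.id - p j • 1) = centeredA p ħ j := by
      rw [map_sub, map_smul, hΦ.map_id, hΦ.map_one, centeredA, Algebra.algebraMap_eq_smul_one]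
    rw [map_add, map_smul, hΦ.map_one, hΦ.map_mul, h1,
      wick_eq_mul _ _ _ fun i => dzbarA_centeredA i j]
  have hcomp : ∀ (c : ℂ) (g : Entire), Entire.compCoord (c • 1 + g * (Entire.id - p j • 1)) j =
      algebraMap ℂ (Smooth n) c + Entire.compCoord g j * centered p j := by
    intro c g
    ext z
    simp [Entire.compCoord, Entire.id, centered, coord]
  rw [← jet_single_compCoord]
  induction k generalizing f with
  | zero =>
    obtain ⟨g, hg⟩ := hdec f
    rw [hg, hΦdec, hcomp, map_add, map_smul, Pi.single_zero, jetA_one, jetA_zero_mul_centeredA,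
      jet_zero_zero]
    simp [centered_apply_self]
  | succ k ih =>
    obtain ⟨g, hg⟩ := hdec f
    rw [hg, hΦdec, hcomp, map_add, map_smul, jetA_single_succ_one, jetA_mul_centeredA, ih,
      jet_add, jet_single_succ_mul p (dz_centered j) (centered_apply_self j), jet_single_succ,
      Derivation.map_algebraMap, jet_zero, smul_zero]

theorem not_isEntireCalculus_coordA (α : ℂ) (j : Fin n) :
    ¬ ∃ Φ : Entire →ₗ[ℂ] Aph p ħ, IsEntireCalculus (wick α) (coordA p ħ j) Φ := by
  rintro ⟨Φ, hΦ⟩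
  exact not_jetA_eq_quarterExp p ħ j (Φ ⟨quarterExp, differentiable_quarterExp⟩) fun k =>
    hΦ.jetA_eq k _

theorem not_isLocallyMConvex (α : ℂ) (j : Fin n) : ¬ IsLocallyMConvex (Aph p ħ) (wick α) := by
  rintro ⟨Q, hQ, hmul⟩
  obtain ⟨s, C, -, hC⟩ :=
    Seminorm.bound_of_continuous hQ (holSeminorm p ħ) (continuous_holSeminorm p ħ)
  set a := centeredA p ħ j
  have hpow : ∀ q ∈ Q, ∀ r : ℕ, q (a ^ r) ≤ q 1 * q a ^ r := by
    intro q hq r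
    induction r with
    | zero => simp
    | succ r ih =>
      rw [pow_succ, ← wick_eq_mul α _ _ fun i => dzbarA_centeredA i j, pow_succ, ← mul_assoc]
      exact (hmul q hq _ _).trans (by gcongr)
  set T := ∑ q ∈ s, (q : Seminorm ℂ (Aph p ħ)) 1
  set ρ := ∑ q ∈ s, (q : Seminorm ℂ (Aph p ħ)) a
  have hT : 0 ≤ T := Finset.sum_nonneg fun q _ => apply_nonneg _ _
  have hρ : 0 ≤ ρ := Finset.sum_nonneg fun q _ => apply_nonneg _ _
  have hhol : ∀ r : ℕ, holSeminorm p ħ (a ^ r) ≤ C * (T * ρ ^ r) := by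
    intro r
    refine (hC _).trans ?_
    change (C : ℝ) * _ ≤ _
    gcongr
    refine Seminorm.finset_sup_apply_le (by positivity) fun q hq => ?_
    refine (hpow q q.2 r).trans ?_
    gcongr
    · exact Finset.single_le_sum (f := fun q : Q => (q : Seminorm ℂ (Aph p ħ)) 1)
        (fun q _ => apply_nonneg _ _) hq
    · exact Finset.single_le_sum (f := fun q : Q => (q : Seminorm ℂ (Aph p ħ)) a)
        (fun q _ => apply_nonneg _ _) hq
  obtain ⟨B, hB0, hB⟩ := exists_norm_jetA_le p ħ j
  refine not_factorial_le_geom ((C * T) ^ 2) ((ρ * B) ^ 2) fun k => ?_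
  have hq := quarterFact_pos k
  have h1 := hB k (a ^ k)
  rw [jetA_centeredA_pow, Complex.norm_natCast, ← quarterFact_pow_four] at h1
  have h2 : quarterFact k ^ 2 ≤ C * T * (ρ * B) ^ k := by
    have h3 : quarterFact k ^ 3 ≤ C * T * (ρ * B) ^ k := by
      rw [← mul_le_mul_iff_left₀ hq]
      calc quarterFact k ^ 3 * quarterFact k = quarterFact k ^ 4 := by ring
        _ ≤ _ := h1
        _ ≤ C * (T * ρ ^ k) * B ^ k * quarterFact k := by gcongr; exact hhol k
        _ = _ := by rw [mul_pow]; ring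
    exact (pow_le_pow_right₀ (one_le_quarterFact k) (by norm_num)).trans h3
  calc (k ! : ℝ) = (quarterFact k ^ 2) ^ 2 := by rw [← quarterFact_pow_four]; ring
    _ ≤ (C * T * (ρ * B) ^ k) ^ 2 := by gcongr
    _ = _ := by rw [mul_pow, ← pow_mul, ← pow_mul, mul_comm k 2]

end space

end WickStar

theorem mainTheorem13 (n : ℕ) (hn : 1 ≤ n) (p : Fin n → ℂ) (ħ : ℝ) [Fact (0 < ħ)] :
    -- `A_{p,ħ}` is not locally `m`-convex for `⋆_α`, whatever `α`
    (∀ α : ℂ, ¬ WickStar.IsLocallyMConvex (WickStar.Aph p ħ) (WickStar.wick α)) ∧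
    -- and it has no general holomorphic (not even an entire) functional calculus
    (∀ α : ℂ, ¬ WickStar.HasEntireCalculus (WickStar.Aph p ħ) (WickStar.wick α)) ∧
    -- the witness `f(w) = ∑ w^r / (r!)^{1/4}`, applied to a coordinate function
    ∃ f : WickStar.Entire,
      (∀ w : ℂ, HasSum (fun r : ℕ => w ^ r / (((r ! : ℝ) ^ (1 / 4 : ℝ) : ℝ) : ℂ))
        ((f : ℂ → ℂ) w)) ∧
      ∀ j : Fin n,
        -- the series of `f ⋆_β f̄` at `0` converges only for `β = 0`
        (∀ β : ℂ, Summable (fun N : Fin n → ℕ =>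
          (WickStar.wickTerm β (WickStar.Entire.compCoord f j) (WickStar.conjSmooth (WickStar.Entire.compCoord f j)) N :
            (Fin n → ℂ) → ℂ) 0) ↔ β = 0) ∧
        -- `f(z^j)` does not belong to `A_{p,ħ}`
        WickStar.Entire.compCoord f j ∉ WickStar.tildeA p ħ ∧
        ∀ α : ℂ,
          -- the `⋆_α`-power series `f(z^j)` does not converge in `A_{p,ħ}`
          (¬ ∃ F : WickStar.Aph p ħ,
            Tendsto (fun M : ℕ => ∑ r ∈ Finset.range M,
              (((r ! : ℝ) ^ (1 / 4 : ℝ) : ℝ) : ℂ)⁻¹ •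
                WickStar.wickPow α (WickStar.coordA p ħ j) r) atTop (𝓝 F)) ∧
          -- and `z^j` has no entire functional calculus at all
          ¬ ∃ Φ : WickStar.Entire →ₗ[ℂ] WickStar.Aph p ħ,
            WickStar.IsEntireCalculus (WickStar.wick α) (WickStar.coordA p ħ j) Φ := by
  have e : ∀ r : ℕ, (((r ! : ℝ) ^ (1 / 4 : ℝ) : ℝ) : ℂ) = (WickStar.quarterFact r : ℂ) :=
    fun _ => rfl
  simp only [e]
  refine ⟨fun α => WickStar.not_isLocallyMConvex α ⟨0, hn⟩, fun α h =>
    WickStar.not_isEntireCalculus_coordA α ⟨0, hn⟩ (h _),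
    ⟨WickStar.quarterExp, WickStar.differentiable_quarterExp⟩, WickStar.hasSum_quarterExp,
    fun j => ⟨fun β => ?_, WickStar.compCoord_quarterExp_notMem j, fun α =>
      ⟨WickStar.not_tendsto_sum_wickPow j α, WickStar.not_isEntireCalculus_coordA α j⟩⟩⟩
  rw [WickStar.summable_wickTerm_iff]
  exact WickStar.summable_quarterExp_iff β
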